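/- Let $\psi_k,\psi^*_k$ ($k\in\mathbb Z$) be free fermions, $[\psi_j,\psi_k]_+=[\psi^*_j,\psi^*_k]_+=0$, $[\psi_j,\psi^*_k]_+=\delta_{jk}$, acting on the fermionic Fock space whose basis states $|S\rangle$ are labelled by the sets $S\subset\mathbb Z$ that contain all sufficiently small integers and no sufficiently large ones ($\psi_k|S\rangle=0$ if $k\in S$, $\psi^*_k|S\rangle=0$ if $k\notin S$; otherwise $\psi_k|S\rangle=\pm|S\cup\{k\}\rangle$ and $\psi_k^*|S\rangle=\pm|S\setminus\{k\}\rangle$). For $c\in\mathbb Z\cup\{\infty\}$, normal ordering $:\ldots:_c$ with respect to the vacuum $|c\rangle$ moves the annihilation operators ($\psi_k$ with $k<c$, $\psi^*_k$ with $k\ge c$) to the right and the other letters to the left, with a sign $-1$ for each transposition; $c=\infty$ is the bare vacuum, $c=0$ the Dirac vacuum $|0\rangle$. For an infinite matrix $A=(A_{ik})_{i,k\in\mathbb Z}$ of complex numbers put $$:\exp(A_{ik}\psi^*_i\psi_k):_c\;=\sum_{m\ge0}\frac1{m!}\sum_{i_1,k_1,\ldots,i_m,k_m}A_{i_1k_1}\cdots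 A_{i_mk_m}:\psi^*_{i_1}\psi_{k_1}\cdots\psi^*_{i_m}\psi_{k_m}:_c\,,$$ understood through its matrix elements $\langle S'|\cdot|S\rangle$, each of which is the limit of the sums with all indices in a finite set $F\subset\mathbb Z$ as $F$ exhausts $\mathbb Z$ (it is well defined if this limit exists). The determinant of an infinite matrix is the limit of its finite principal minors with rows and columns in $F$, as $F$ exhausts $\mathbb Z$; it converges if this limit exists. Let $n\in\mathbb Z$, let $P=P_{\ge n}$ be the projector $P_{ik}=\delta_{ik}$ for $i,k\ge n$ and $0$ otherwise, and let $A,B$ be infinite complex matrices connected by $$B-A=APB .$$ Assume that $(I+PB)^{-1}$ and the products are meaningful in the following sense: for some weights $w_k>0$, one has $\sum_{k\ge n}|A_{ik}|^2w_k^{-2}<\infty$ for every $i\in\mathbb Z$ and $\sum_{i\ge n}w_i^2|B_{ik}|^2<\infty$ for every $k\in\mathbb Z$, and the matrix $(w_iB_{ik}w_k^{-1})_{i,k\ge n}$ is the matrix of a compact operator $K$ on $\ell^2(\{k\ge n\})$ such that $I+K$ is invertible. Assume also that $\det(I+PB)$ converges. Then: 1. $A=B(I+PB)^{-1}$ and $B=(I-AP)^{-1}A$,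 the inverses being two-sided inverses of infinite matrices; 2. all matrix elements of $:\exp(B_{ik}\psi^*_i\psi_k):_\infty$ and of $:\exp(A_{ik}\psi^*_i\psi_k):_n$ are well defined, and $$:\exp(B_{ik}\psi^*_i\psi_k):_\infty\;=\;\det(I+PB)\;:\exp(A_{ik}\psi^*_i\psi_k):_n\,;$$ 3. if $\det(I+PB)\neq0$, then $\det(I-PA)$ converges too, and $$:\exp(A_{ik}\psi^*_i\psi_k):_n\;=\;\det(I-PA)\;:\exp(B_{ik}\psi^*_i\psi_k):_\infty\,.$$ For $n=0$ this compares the bare vacuum with the Dirac vacuum $|0\rangle$. -/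

import Mathlib

noncomputable section

namespace FreeFermion

/-- A Maya diagram: a set of integers containing all sufficiently small integers and no sufficiently
large ones.  These sets label the basis states of the fermionic Fock space (all charges together):
`k ∈ S` means that `ψ_k` kills the basis state of `S`, and `k ∉ S` that `ψ*_k` does. -/
structure Maya where
  modes : Set ℤ
  lower : ∃ N : ℤ, ∀ k < N, k ∈ modes
  upper : ∃ N : ℤ, ∀ k, N ≤ k → k ∉ modes

/-- `S ∪ {k}`. -/
def Maya.insert (S : Maya) (k : ℤ) : Maya where
  modes := S.modes ∪ {k}
  lower := by
    obtain ⟨N, hN⟩ := S.lower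
    exact ⟨N, fun j hj => Or.inl (hN j hj)⟩
  upper := by
    obtain ⟨N, hN⟩ := S.upper
    refine ⟨max N (k + 1), fun j hj => ?_⟩
    rintro (h | h)
    · exact hN j (le_trans (le_max_left _ _) hj) h
    · have h1 : j = k := h
      have h2 := le_trans (le_max_right N (k + 1)) hj
      omega

/-- `S \ {k}`. -/
def Maya.erase (S : Maya) (k : ℤ) : Maya where
  modes := S.modes \ {k}
  lower := by
    obtain ⟨N, hN⟩ := S.lower
    refine ⟨min N k, fun j hj => ⟨hN j (lt_of_lt_of_le hj (min_le_left _ _)), ?_⟩⟩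
    intro h
    have h1 : j = k := h
    have h2 := lt_of_lt_of_le hj (min_le_right N k)
    omega
  upper := by
    obtain ⟨N, hN⟩ := S.upper
    exact ⟨N, fun j hj h => hN j hj h.1⟩

/-- The sign `(-1)^{#{j ∈ S : j > k}}` picked up when `ψ_k` or `ψ*_k` is moved to its place in the
semi-infinite product `ψ_{s₁} ψ_{s₂} ψ_{s₃} ⋯`, where `s₁ > s₂ > s₃ > ⋯` are the elements of `S`. -/
def Maya.sign (S : Maya) (k : ℤ) : ℂ := (-1) ^ Set.ncard {j : ℤ | j ∈ S.modes ∧ k < j}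

/-- The fermionic Fock space, with basis the Maya diagrams. -/
abbrev Fock : Type := Maya →₀ ℂ

open Classical in
/-- The operator `ψ_k` on the Fock space. -/
def psi (k : ℤ) : Module.End ℂ Fock :=
  Finsupp.linearCombination ℂ fun S : Maya =>
    if k ∈ S.modes then 0 else Finsupp.single (S.insert k) (S.sign k)

open Classical in
/-- The operator `ψ*_k` on the Fock space. -/
def psiStar (k : ℤ) : Module.End ℂ Fock :=
  Finsupp.linearCombination ℂ fun S : Maya =>
    if k ∈ S.modes then Finsupp.single (S.erase k) (S.sign k) else 0

/-- The matrix element `⟨S'| X |S⟩` of an operator between two basis states. -/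
def matrixElement (X : Module.End ℂ Fock) (S' S : Maya) : ℂ := X (Finsupp.single S 1) S'

/-- The letters `ψ_k`, `ψ*_k` of a word under the sign of normal ordering. -/
inductive Letter where
  | psi (k : ℤ)
  | psiStar (k : ℤ)

/-- The operator that a letter stands for. -/
def Letter.op : Letter → Module.End ℂ Fock
  | .psi k => FreeFermion.psi k
  | .psiStar k => FreeFermion.psiStar k

/-- Annihilation operators with respect to the vacuum `|c⟩`: the `ψ_k` with `k < c` and the `ψ*_k`
with `k ≥ c`.  Here `c` is an integer (a Dirac vacuum `|n⟩`) or `⊤` (the bare vacuum `|∞⟩`, all of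
whose annihilation operators are the `ψ_k`). -/
def Letter.IsAnnihilation (c : WithTop ℤ) : Letter → Prop
  | .psi k => (k : WithTop ℤ) < c
  | .psiStar k => c ≤ (k : WithTop ℤ)

open Classical in
/-- The sign of the permutation that moves all creation operators of a word to the left and all its
annihilation operators to the right: `-1` for each annihilation operator standing to the left of a
creation operator. -/
def orderingSign (c : WithTop ℤ) : List Letter → ℂ
  | [] => 1
  | f :: l =>
    if f.IsAnnihilation c then
      (-1) ^ (l.filter fun g => decide (¬ g.IsAnnihilation c)).length * orderingSign c l
    else orderingSign c l

open Classical in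
/-- The normally ordered product of a word, with respect to the vacuum `|c⟩`. -/
def normalOrder (c : WithTop ℤ) (l : List Letter) : Module.End ℂ Fock :=
  orderingSign c l •
    (((l.filter fun g => decide (¬ g.IsAnnihilation c)).map Letter.op).prod *
      ((l.filter fun g => decide (g.IsAnnihilation c)).map Letter.op).prod)

/-- The word `ψ*_{i₁} ψ_{k₁} ψ*_{i₂} ψ_{k₂} ⋯ ψ*_{iₘ} ψ_{kₘ}`. -/
def bilinearWord {m : ℕ} (p : Fin m → ℤ × ℤ) : List Letter :=
  (List.ofFn p).flatMap fun q => [Letter.psiStar q.1, Letter.psi q.2]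

/-- The matrix element between `⟨S'|` and `|S⟩` of the normally ordered exponent of
`∑_{i,k ∈ F} A_{ik} ψ*_i ψ_k`, i.e. of
`∑ₘ (1/m!) ∑_{i₁,k₁,…,iₘ,kₘ ∈ F} A_{i₁k₁} ⋯ A_{iₘkₘ} :ψ*_{i₁} ψ_{k₁} ⋯ ψ*_{iₘ} ψ_{kₘ}:`.
Only the terms with `m ≤ #F` can be nonzero. -/
def cutExp (c : WithTop ℤ) (A : Matrix ℤ ℤ ℂ) (S' S : Maya) (F : Finset ℤ) : ℂ :=
  ∑' m : ℕ, ((m.factorial : ℂ))⁻¹ *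
    ∑ p ∈ Fintype.piFinset fun _ : Fin m => F ×ˢ F,
      (∏ a, A (p a).1 (p a).2) * matrixElement (normalOrder c (bilinearWord p)) S' S

/-- The matrix element `⟨S'| :exp(∑_{i,k ∈ ℤ} A_{ik} ψ*_i ψ_k): |S⟩` is well defined: the sums over
finite sets `F` of modes converge as `F` exhausts `ℤ`. -/
def NormalExpConverges (c : WithTop ℤ) (A : Matrix ℤ ℤ ℂ) (S' S : Maya) : Prop :=
  ∃ x : ℂ, Filter.Tendsto (cutExp c A S' S) Filter.atTop (nhds x)

/-- The matrix element `⟨S'| :exp(∑_{i,k ∈ ℤ} A_{ik} ψ*_i ψ_k): |S⟩`, normal ordering with respect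
to the vacuum `|c⟩`. -/
def normalExp (c : WithTop ℤ) (A : Matrix ℤ ℤ ℂ) (S' S : Maya) : ℂ :=
  Filter.limUnder Filter.atTop (cutExp c A S' S)

/-- The product of infinite matrices. -/
def infMul (X Y : Matrix ℤ ℤ ℂ) : Matrix ℤ ℤ ℂ := Matrix.of fun i k => ∑' j : ℤ, X i j * Y j k

/-- The matrices `X` and `Y` are inverse to each other. -/
def AreInverse (X Y : Matrix ℤ ℤ ℂ) : Prop := infMul X Y = 1 ∧ infMul Y X = 1

/-- The projector `P_{≥ n}` on the modes `≥ n` (so `P_+` is `proj 0`). -/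
def proj (n : ℤ) : Matrix ℤ ℤ ℂ := Matrix.diagonal fun k => if n ≤ k then 1 else 0

/-- The principal minor of an infinite matrix with rows and columns in `F`. -/
def cutDet (X : Matrix ℤ ℤ ℂ) (F : Finset ℤ) : ℂ :=
  (X.submatrix (Subtype.val : F → ℤ) (Subtype.val : F → ℤ)).det

/-- The infinite determinant is well defined: the finite principal minors converge. -/
def InfDetConverges (X : Matrix ℤ ℤ ℂ) : Prop :=
  ∃ d : ℂ, Filter.Tendsto (cutDet X) Filter.atTop (nhds d)

/-- The determinant of an infinite matrix: the limit of its finite principal minors. -/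
def infDet (X : Matrix ℤ ℤ ℂ) : ℂ := Filter.limUnder Filter.atTop (cutDet X)

end FreeFermion

end

open FreeFermion

/-!
Write `X = :exp(A):_n` and `Y = :exp(B):_∞`. The proof has an algebraic part, in finitely many modes,
and an analytic part, the passage to the limit.

*Finitely many modes* `F`. Moving `ψ*_k` through a normally ordered exponent contracts it once with
each pair `ψ*_i ψ_k` (`commStar_expOp`). For the bare vacuum this gives
`Y ψ*_k = ∑_i (1 + B)_{ik} ψ*_i Y` (`expOp_top_mul_psiStar`). For the vacuum `|n⟩` the operators
`ψ*_i` with `i ≥ n` come out on the other side of `X`, and solving the resulting linear equations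
turns `A` into `B`: if `B - A = B P A`, then `X` satisfies *the same* relation as `Y`
(`expOp_mul_psiStar`). As the state with all modes of `F` filled is an eigenvector of both operators,
by conservation of charge, and as the `ψ*_k` generate all other states from it, `X` and `Y` are
proportional (`apply_single_eq_smul`). The factor is found in the state with exactly the modes `< n`
of `F` filled. There the expectation value of `X` is `1`, the state being a vacuum state, and that of
`Y` is the determinant of `1 + B` on the modes `≥ n` of `F`, as `ψ*(v₁) ⋯ ψ*(v_r)` is alternating
in the vectors `v_a` (`cutExp_top_of_empty`). This proves the theorem for matrices on `F`
(`cutExp_top_eq`).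

*The limit.* A mode that is occupied in both states as in the vacuum does not contribute to the
matrix element (`cutExp_eq_of_vacuum`). So the matrix elements of `X` depend on finitely many entries
of `A` only. The cut-off of `B` to `F` is related as above to a matrix `A_F` which is not the cut-off
of `A`; in terms of the compact operator `K` on `ℓ²` with coordinate projections `P_F`, it comes from
`(1 + P_F K)⁻¹`. Compactness gives `P_F K → K` in norm, hence `A_F → A` entrywise
(`WeightedSystem.tendsto_approx`), and `cutExp_top_eq` for `F` turns in the limit into the
identity between `X` and `Y` (`WeightedSystem.tendsto_cutExp_top`).

*The inverse determinant.* The principal minors of `1 - PA` are those of `(1 + K)⁻¹`. By Jacobi's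
identity (`opMinor_jacobi`) the minor of `(1 + P_{G'} K)⁻¹` on `G`, multiplied by the minor of `1 + K`
on `G'`, is the minor of `1 + K` on `G' \ G`. The latter is close to `1` once `G` is large: this is
where both the convergence of `det (1 + PB)` to a nonzero value and the compactness of `K` are used
(`eventually_opMinor_tail`). Hence the minors of `1 - PA` converge to `det (1 + PB)⁻¹`
(`tendsto_opMinor_inverse`).
-/

noncomputable section

namespace FreeFermion

section

/-- The algebra of operators on the Fock space. -/
abbrev Op : Type := Module.End ℂ Fock

/-- The ring structure of the operators, with `-X = (-1) • X`. Without this instance and the three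
below it, the negatives and differences found for operators are those of linear maps into an
additive group, and these do not unify with the ones of the ring at the transparency of `rw`. -/
instance Op.instRing : Ring Op := Algebra.semiringToRing ℂ

instance Op.instNeg : Neg Op := Op.instRing.toNeg

instance Op.instSub : Sub Op := Op.instRing.toSub

instance Op.instAddCommGroup : AddCommGroup Op := Op.instRing.toAddCommGroup

theorem Op.neg_apply (x : Op) (v : Fock) : (-x) v = (-1 : ℂ) • x v := by
  rw [← neg_one_smul ℂ x, LinearMap.smul_apply]

theorem Op.sub_apply (x y : Op) (v : Fock) : (x - y) v = x v + (-1 : ℂ) • y v := by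
  rw [sub_eq_add_neg, LinearMap.add_apply, Op.neg_apply]

/-! ### Canonical anticommutation relations -/

theorem Maya.ext_modes {S T : Maya} (h : S.modes = T.modes) : S = T := by
  cases S; cases T; cases h; rfl

theorem Maya.mem_insert {S : Maya} {j k : ℤ} : j ∈ (S.insert k).modes ↔ j = k ∨ j ∈ S.modes := by
  simp [Maya.insert]

theorem Maya.mem_erase {S : Maya} {j k : ℤ} : j ∈ (S.erase k).modes ↔ j ≠ k ∧ j ∈ S.modes := by
  simp [Maya.erase, and_comm]

theorem Maya.insert_comm (S : Maya) (j k : ℤ) : (S.insert j).insert k = (S.insert k).insert j :=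
  Maya.ext_modes (by ext; simp only [Maya.mem_insert]; tauto)

theorem Maya.erase_comm (S : Maya) (j k : ℤ) : (S.erase j).erase k = (S.erase k).erase j :=
  Maya.ext_modes (by ext; simp only [Maya.mem_erase]; tauto)

theorem Maya.insert_erase_comm (S : Maya) {j k : ℤ} (h : j ≠ k) :
    (S.insert j).erase k = (S.erase k).insert j :=
  Maya.ext_modes (by ext x; simp only [Maya.mem_erase, Maya.mem_insert]; grind)

theorem Maya.erase_insert (S : Maya) {k : ℤ} (h : k ∈ S.modes) : (S.erase k).insert k = S :=
  Maya.ext_modes (by ext x; simp only [Maya.mem_erase, Maya.mem_insert]; grind)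

theorem Maya.insert_erase (S : Maya) {k : ℤ} (h : k ∉ S.modes) : (S.insert k).erase k = S :=
  Maya.ext_modes (by ext x; simp only [Maya.mem_erase, Maya.mem_insert]; grind)

theorem Maya.finite_above (S : Maya) (k : ℤ) : {j : ℤ | j ∈ S.modes ∧ k < j}.Finite := by
  obtain ⟨N, hN⟩ := S.upper
  refine (Set.finite_Ioo k N).subset fun j hj => ⟨hj.2, ?_⟩
  by_contra h
  exact hN j (not_lt.mp h) hj.1

theorem Maya.sign_insert (S : Maya) {j : ℤ} (k : ℤ) (h : j ∉ S.modes) :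
    (S.insert j).sign k = (if k < j then -1 else 1) * S.sign k := by
  unfold Maya.sign
  split_ifs with hk
  · have : {i : ℤ | i ∈ (S.insert j).modes ∧ k < i} =
        Insert.insert j {i : ℤ | i ∈ S.modes ∧ k < i} := by
      ext x; simp only [Set.mem_ofPred_eq, Maya.mem_insert, Set.mem_insert_iff]; grind
    rw [this, Set.ncard_insert_of_notMem (fun h' => h h'.1) (S.finite_above k), pow_succ]
    ring
  · have : {i : ℤ | i ∈ (S.insert j).modes ∧ k < i} = {i : ℤ | i ∈ S.modes ∧ k < i} := by
      ext x; simp only [Set.mem_ofPred_eq, Maya.mem_insert]; grind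
    rw [this, one_mul]

theorem Maya.sign_mul_self (S : Maya) (k : ℤ) : S.sign k * S.sign k = 1 := by
  unfold Maya.sign
  rw [← mul_pow]; simp

theorem Maya.sign_erase (S : Maya) {j : ℤ} (k : ℤ) (h : j ∈ S.modes) :
    (S.erase j).sign k = (if k < j then -1 else 1) * S.sign k := by
  have h1 := (S.erase j).sign_insert (j := j) k (by simp [Maya.mem_erase])
  rw [S.erase_insert h] at h1
  rw [h1, ← mul_assoc]
  split_ifs <;> simp

theorem Maya.sign_insert_self (S : Maya) (k : ℤ) : (S.insert k).sign k = S.sign k := by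
  unfold Maya.sign
  congr 2
  ext x; simp only [Set.mem_ofPred_eq, Maya.mem_insert]; grind

theorem Maya.sign_erase_self (S : Maya) (k : ℤ) : (S.erase k).sign k = S.sign k := by
  unfold Maya.sign
  congr 2
  ext x; simp only [Set.mem_ofPred_eq, Maya.mem_erase]; grind

theorem psi_single_of_mem {S : Maya} {k : ℤ} (h : k ∈ S.modes) :
    psi k (Finsupp.single S 1) = 0 := by
  simp [psi, h]

theorem psi_single_of_notMem {S : Maya} {k : ℤ} (h : k ∉ S.modes) :
    psi k (Finsupp.single S 1) = S.sign k • Finsupp.single (S.insert k) 1 := by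
  simp [psi, h]

theorem psiStar_single_of_mem {S : Maya} {k : ℤ} (h : k ∈ S.modes) :
    psiStar k (Finsupp.single S 1) = S.sign k • Finsupp.single (S.erase k) 1 := by
  simp [psiStar, h]

theorem psiStar_single_of_notMem {S : Maya} {k : ℤ} (h : k ∉ S.modes) :
    psiStar k (Finsupp.single S 1) = 0 := by
  simp [psiStar, h]

theorem Fock.ext_basis {X Y : Module.End ℂ Fock}
    (h : ∀ S : Maya, X (Finsupp.single S 1) = Y (Finsupp.single S 1)) : X = Y :=
  Finsupp.lhom_ext' fun S => LinearMap.ext_ring (h S)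

theorem psi_mul_self (k : ℤ) : psi k * psi k = 0 := by
  refine Fock.ext_basis fun S => ?_
  by_cases h : k ∈ S.modes
  · simp [-Finsupp.smul_single, psi_single_of_mem h]
  · have : k ∈ (S.insert k).modes := by simp [Maya.mem_insert]
    simp [-Finsupp.smul_single, psi_single_of_notMem h, psi_single_of_mem this]

theorem psiStar_mul_self (k : ℤ) : psiStar k * psiStar k = 0 := by
  refine Fock.ext_basis fun S => ?_
  by_cases h : k ∈ S.modes
  · have : k ∉ (S.erase k).modes := by simp [Maya.mem_erase]
    simp [-Finsupp.smul_single, psiStar_single_of_mem h, psiStar_single_of_notMem this]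
  · simp [-Finsupp.smul_single, psiStar_single_of_notMem h]

theorem psi_mul_psi (j k : ℤ) : psi j * psi k = -(psi k * psi j) := by
  rcases eq_or_ne j k with rfl | hjk
  · rw [psi_mul_self, neg_zero]
  refine Fock.ext_basis fun S => ?_
  by_cases hj : j ∈ S.modes <;> by_cases hk : k ∈ S.modes
  · simp [-Finsupp.smul_single, Op.neg_apply, psi_single_of_mem hj, psi_single_of_mem hk]
  · have : j ∈ (S.insert k).modes := by simp [Maya.mem_insert, hj]
    simp [-Finsupp.smul_single, Op.neg_apply, psi_single_of_mem hj, psi_single_of_notMem hk,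
      psi_single_of_mem this]
  · have : k ∈ (S.insert j).modes := by simp [Maya.mem_insert, hk]
    simp [-Finsupp.smul_single, Op.neg_apply, psi_single_of_notMem hj, psi_single_of_mem hk,
      psi_single_of_mem this]
  · have h1 : k ∉ (S.insert j).modes := by simp [Maya.mem_insert, hk, hjk.symm]
    have h2 : j ∉ (S.insert k).modes := by simp [Maya.mem_insert, hj, hjk]
    simp only [Module.End.mul_apply, Op.neg_apply, psi_single_of_notMem hj,
      psi_single_of_notMem hk, map_smul, psi_single_of_notMem h1, psi_single_of_notMem h2,
      S.insert_comm j k, smul_smul, S.sign_insert _ hj, S.sign_insert _ hk]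
    congr 1
    rcases lt_or_gt_of_ne hjk with h | h <;> simp [h, h.not_gt] <;> ring

theorem psiStar_mul_psiStar (j k : ℤ) : psiStar j * psiStar k = -(psiStar k * psiStar j) := by
  rcases eq_or_ne j k with rfl | hjk
  · rw [psiStar_mul_self, neg_zero]
  refine Fock.ext_basis fun S => ?_
  by_cases hj : j ∈ S.modes <;> by_cases hk : k ∈ S.modes
  · have h1 : k ∈ (S.erase j).modes := by simp [Maya.mem_erase, hk, hjk.symm]
    have h2 : j ∈ (S.erase k).modes := by simp [Maya.mem_erase, hj, hjk]
    simp only [Module.End.mul_apply, Op.neg_apply, psiStar_single_of_mem hj,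
      psiStar_single_of_mem hk, map_smul, psiStar_single_of_mem h1, psiStar_single_of_mem h2,
      S.erase_comm j k, smul_smul, S.sign_erase _ hj, S.sign_erase _ hk]
    congr 1
    rcases lt_or_gt_of_ne hjk with h | h <;> simp [h, h.not_gt] <;> ring
  · have : k ∉ (S.erase j).modes := by simp [Maya.mem_erase, hk]
    simp [-Finsupp.smul_single, Op.neg_apply, psiStar_single_of_mem hj, psiStar_single_of_notMem hk,
      psiStar_single_of_notMem this]
  · have : j ∉ (S.erase k).modes := by simp [Maya.mem_erase, hj]
    simp [-Finsupp.smul_single, Op.neg_apply, psiStar_single_of_notMem hj, psiStar_single_of_mem hk,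
      psiStar_single_of_notMem this]
  · simp [-Finsupp.smul_single, Op.neg_apply, psiStar_single_of_notMem hj,
      psiStar_single_of_notMem hk]

theorem psi_mul_psiStar_of_ne {j k : ℤ} (hjk : j ≠ k) :
    psi j * psiStar k = -(psiStar k * psi j) := by
  refine Fock.ext_basis fun S => ?_
  by_cases hj : j ∈ S.modes <;> by_cases hk : k ∈ S.modes
  · have : j ∈ (S.erase k).modes := by simp [Maya.mem_erase, hj, hjk]
    simp [-Finsupp.smul_single, Op.neg_apply, psi_single_of_mem hj, psiStar_single_of_mem hk,
      psi_single_of_mem this]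
  · simp [-Finsupp.smul_single, Op.neg_apply, psi_single_of_mem hj, psiStar_single_of_notMem hk]
  · have h1 : k ∈ (S.insert j).modes := by simp [Maya.mem_insert, hk]
    have h2 : j ∉ (S.erase k).modes := by simp [Maya.mem_erase, hj]
    simp only [Module.End.mul_apply, Op.neg_apply, psi_single_of_notMem hj,
      psiStar_single_of_mem hk, map_smul, psiStar_single_of_mem h1, psi_single_of_notMem h2,
      S.insert_erase_comm hjk, smul_smul, S.sign_insert _ hj, S.sign_erase _ hk]
    congr 1
    rcases lt_or_gt_of_ne hjk with h | h <;> simp [h, h.not_gt] <;> ring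
  · have : k ∉ (S.insert j).modes := by simp [Maya.mem_insert, hk, hjk.symm]
    simp [-Finsupp.smul_single, Op.neg_apply, psi_single_of_notMem hj, psiStar_single_of_notMem hk,
      psiStar_single_of_notMem this]

theorem psi_mul_psiStar_self (k : ℤ) : psi k * psiStar k = 1 - psiStar k * psi k := by
  refine Fock.ext_basis fun S => ?_
  by_cases hk : k ∈ S.modes
  · have : k ∉ (S.erase k).modes := by simp [Maya.mem_erase]
    simp only [Module.End.mul_apply, Op.sub_apply, psiStar_single_of_mem hk, map_smul,
      psi_single_of_notMem this, S.erase_insert hk, smul_smul, S.sign_erase_self, S.sign_mul_self,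
      psi_single_of_mem hk, map_zero, smul_zero, add_zero, one_smul, Module.End.one_apply]
  · have : k ∈ (S.insert k).modes := by simp [Maya.mem_insert]
    simp only [Module.End.mul_apply, Op.sub_apply, psi_single_of_notMem hk, map_smul,
      psiStar_single_of_mem this, S.insert_erase hk, smul_smul, S.sign_insert_self,
      S.sign_mul_self, psiStar_single_of_notMem hk, map_zero, one_smul, Module.End.one_apply]
    simp

end

section

/-! ### Products of anticommuting operators -/

theorem mul_prod_of_anticommute {x : Op} {l : List Op} (h : ∀ y ∈ l, x * y = -(y * x)) :
    x * l.prod = (-1 : ℂ) ^ l.length • (l.prod * x) := by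
  induction l with
  | nil => simp
  | cons y l ih =>
    rw [List.prod_cons, ← mul_assoc, h y (by simp), neg_mul, mul_assoc,
      ih fun z hz => h z (by simp [hz]), List.length_cons, pow_succ]
    simp [mul_assoc]

theorem prod_apply_eq_zero_of_mem {x : Op} {l : List Op} (h : ∀ y ∈ l, x * y = -(y * x))
    (hx : x ∈ l) {v : Fock} (hv : x v = 0) : l.prod v = 0 := by
  obtain ⟨l₁, l₂, rfl⟩ := List.append_of_mem hx
  rw [List.prod_append, List.prod_cons, mul_prod_of_anticommute fun y hy => h y (by simp [hy])]
  simp [hv]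

theorem prod_apply_apply_eq_zero_of_mem {x : Op} {l : List Op}
    (h : ∀ y ∈ l, x * y = -(y * x)) (hx : x ∈ l) {S' : Maya} (hS : ∀ v, x v S' = 0) (v : Fock) :
    l.prod v S' = 0 := by
  obtain ⟨l₁, l₂, rfl⟩ := List.append_of_mem hx
  have h1 := mul_prod_of_anticommute (x := x) (l := l₁) fun y hy => h y (by simp [hy])
  have h2 : l₁.prod * x = (-1 : ℂ) ^ l₁.length • (x * l₁.prod) := by
    rw [h1, smul_smul, ← mul_pow]; simp
  rw [List.prod_append, List.prod_cons, ← mul_assoc, h2]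
  simp [hS]

theorem prod_eq_zero_of_not_nodup {l : List Op} (h : ∀ x ∈ l, ∀ y ∈ l, x * y = -(y * x))
    (hsq : ∀ x ∈ l, x * x = 0) (hl : ¬ l.Nodup) : l.prod = 0 := by
  induction l with
  | nil => simp at hl
  | cons x l ih =>
    rw [List.prod_cons]
    by_cases hx : x ∈ l
    · obtain ⟨l₁, l₂, rfl⟩ := List.append_of_mem hx
      rw [List.prod_append, List.prod_cons, ← mul_assoc,
        mul_prod_of_anticommute fun y hy => h x (by simp) y (by simp [hy])]
      rw [smul_mul_assoc, mul_assoc, ← mul_assoc x x, hsq x (by simp)]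
      simp
    · rw [ih (fun y hy z hz => h y (by simp [hy]) z (by simp [hz]))
        (fun y hy => hsq y (by simp [hy])) (by simpa [hx] using hl), mul_zero]

/-! ### Normal ordering -/

variable {c : WithTop ℤ}

theorem Letter.op_mul_self (f : Letter) : f.op * f.op = 0 := by
  cases f
  · exact psi_mul_self _
  · exact psiStar_mul_self _

/-- Letters of the same kind, creation or annihilation, anticommute: such a `ψ_j` and `ψ*_k` have
`j ≠ k`. -/
theorem Letter.op_anticommute {f g : Letter} (h : f.IsAnnihilation c ↔ g.IsAnnihilation c) :
    f.op * g.op = -(g.op * f.op) := by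
  cases f <;> cases g <;> simp only [Letter.IsAnnihilation] at h
  · exact psi_mul_psi _ _
  · refine psi_mul_psiStar_of_ne ?_
    rintro rfl
    grind
  · refine neg_eq_iff_eq_neg.1 (psi_mul_psiStar_of_ne ?_).symm
    rintro rfl
    grind
  · exact psiStar_mul_psiStar _ _

theorem normalOrder_nil : normalOrder c [] = 1 := by
  simp [normalOrder, orderingSign]

theorem normalOrder_cons_creation {f : Letter} (h : ¬ f.IsAnnihilation c) (l : List Letter) :
    normalOrder c (f :: l) = f.op * normalOrder c l := by
  simp [normalOrder, orderingSign, h, mul_assoc]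

open Classical in
/-- The sign counts all letters of `l`: the ordering sign has a `-1` for each creation letter, and a
further one for each annihilation letter arises when `f` is moved to the far right. -/
theorem normalOrder_cons_annihilation {f : Letter} (h : f.IsAnnihilation c) (l : List Letter) :
    normalOrder c (f :: l) = (-1 : ℂ) ^ l.length • (normalOrder c l * f.op) := by
  have h1 : f.op * ((l.filter fun g => decide (g.IsAnnihilation c)).map Letter.op).prod =
      (-1 : ℂ) ^ (l.filter fun g => decide (g.IsAnnihilation c)).length •
        (((l.filter fun g => decide (g.IsAnnihilation c)).map Letter.op).prod * f.op) := by
    rw [mul_prod_of_anticommute, List.length_map]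
    intro y hy
    obtain ⟨g, hg, rfl⟩ := List.mem_map.1 hy
    exact Letter.op_anticommute (c := c) (iff_of_true h (by simpa using (List.mem_filter.1 hg).2))
  have h2 : l.length = (l.filter fun g => decide (¬ g.IsAnnihilation c)).length +
      (l.filter fun g => decide (g.IsAnnihilation c)).length := by
    rw [add_comm]
    simpa using (List.length_eq_length_filter_add
      (l := l) fun g => decide (g.IsAnnihilation c))
  rw [h2, pow_add]
  simp only [normalOrder, orderingSign, h, if_true, not_true_eq_false, decide_false, decide_true,
    List.filter_cons, Bool.false_eq_true, if_false, List.map_cons, List.prod_cons, h1]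
  simp only [mul_smul_comm, smul_mul_assoc, smul_smul, mul_assoc]
  congr 1
  ring

open Classical in
theorem normalOrder_apply_eq_zero {f : Letter} {l : List Letter} (hf : f ∈ l)
    (h : f.IsAnnihilation c) {v : Fock} (hv : f.op v = 0) : normalOrder c l v = 0 := by
  have : ((l.filter fun g => decide (g.IsAnnihilation c)).map Letter.op).prod v = 0 := by
    refine prod_apply_eq_zero_of_mem (x := f.op) ?_ ?_ hv
    · intro y hy
      obtain ⟨g, hg, rfl⟩ := List.mem_map.1 hy
      exact Letter.op_anticommute (c := c) (iff_of_true h (by simpa using (List.mem_filter.1 hg).2))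
    · exact List.mem_map_of_mem (List.mem_filter.2 ⟨hf, by simpa using h⟩)
  simp only [normalOrder, LinearMap.smul_apply, Module.End.mul_apply, this, map_zero, smul_zero]

open Classical in
theorem normalOrder_apply_apply_eq_zero {f : Letter} {l : List Letter} (hf : f ∈ l)
    (h : ¬ f.IsAnnihilation c) {S' : Maya} (hS : ∀ v, f.op v S' = 0) (v : Fock) :
    normalOrder c l v S' = 0 := by
  simp only [normalOrder, LinearMap.smul_apply, Module.End.mul_apply, Finsupp.smul_apply]
  rw [prod_apply_apply_eq_zero_of_mem (x := f.op) _ _ hS, smul_zero]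
  · intro y hy
    obtain ⟨g, hg, rfl⟩ := List.mem_map.1 hy
    exact Letter.op_anticommute (c := c) (iff_of_false h (by simpa using (List.mem_filter.1 hg).2))
  · exact List.mem_map_of_mem (List.mem_filter.2 ⟨hf, by simpa using h⟩)

open Classical in
theorem normalOrder_eq_zero_of_not_nodup {l : List Letter} (hl : ¬ l.Nodup) :
    normalOrder c l = 0 := by
  have key : ∀ (p : Letter → Prop) [DecidablePred p],
      (∀ f g, p f → p g → (f.IsAnnihilation c ↔ g.IsAnnihilation c)) →
      ¬ (l.filter fun g => decide (p g)).Nodup →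
      ((l.filter fun g => decide (p g)).map Letter.op).prod = 0 := by
    intro p _ hp hn
    refine prod_eq_zero_of_not_nodup ?_ ?_ fun h => hn (List.Nodup.of_map _ h)
    · intro x hx y hy
      obtain ⟨f, hf, rfl⟩ := List.mem_map.1 hx
      obtain ⟨g, hg, rfl⟩ := List.mem_map.1 hy
      exact Letter.op_anticommute (hp f g (by simpa using (List.mem_filter.1 hf).2)
        (by simpa using (List.mem_filter.1 hg).2))
    · intro x hx
      obtain ⟨f, hf, rfl⟩ := List.mem_map.1 hx
      exact f.op_mul_self
  unfold normalOrder
  by_cases h1 : (l.filter fun g => decide (g.IsAnnihilation c)).Nodup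
  · by_cases h2 : (l.filter fun g => decide (¬ g.IsAnnihilation c)).Nodup
    · exfalso
      apply hl
      have hp := List.filter_append_perm (fun g => decide (g.IsAnnihilation c)) l
      refine hp.nodup_iff.1 (h1.append (by simpa using h2) ?_)
      intro f hf hf'
      simp_all
    · rw [key (fun g => ¬ g.IsAnnihilation c) (by grind) h2, zero_mul, smul_zero]
  · rw [key _ (by grind) h1, mul_zero, smul_zero]

theorem bilinearWord_succ {m : ℕ} (p : Fin (m + 1) → ℤ × ℤ) :
    bilinearWord p = .psiStar (p 0).1 :: .psi (p 0).2 :: bilinearWord (Fin.tail p) := by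
  simp [bilinearWord, List.ofFn_succ, Fin.tail_def]

theorem length_bilinearWord {m : ℕ} (p : Fin m → ℤ × ℤ) : (bilinearWord p).length = 2 * m := by
  induction m with
  | zero => simp [bilinearWord]
  | succ m ih => rw [bilinearWord_succ]; simp [ih]; ring

theorem psiStar_mem_bilinearWord {m : ℕ} (p : Fin m → ℤ × ℤ) (a : Fin m) :
    .psiStar (p a).1 ∈ bilinearWord p := by
  simp only [bilinearWord, List.mem_flatMap]
  exact ⟨p a, List.mem_ofFn.2 ⟨a, rfl⟩, by simp⟩

theorem psi_mem_bilinearWord {m : ℕ} (p : Fin m → ℤ × ℤ) (a : Fin m) :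
    .psi (p a).2 ∈ bilinearWord p := by
  simp only [bilinearWord, List.mem_flatMap]
  exact ⟨p a, List.mem_ofFn.2 ⟨a, rfl⟩, by simp⟩

theorem injective_of_nodup_bilinearWord {m : ℕ} {p : Fin m → ℤ × ℤ} (h : (bilinearWord p).Nodup) :
    Function.Injective fun a => (p a).2 := by
  have hs : ∀ l : List (ℤ × ℤ), (l.map fun q => Letter.psi q.2).Sublist
      (l.flatMap fun q => [Letter.psiStar q.1, Letter.psi q.2]) := by
    intro l
    induction l with
    | nil => simp
    | cons q l ih => simpa using (ih.cons_cons _).cons _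
  have h1 := (hs (List.ofFn p)).nodup h
  rw [List.map_ofFn, List.nodup_ofFn] at h1
  intro a b hab
  exact h1 (congrArg Letter.psi hab)

end

section

/-! ### The normally ordered exponent of a finite matrix -/

variable {c : WithTop ℤ}

/-- The map `:W:_c ↦ :ψ_k W:_c` on normally ordered words of even length, where the letter `ψ_k`
goes to the right of all of `W` if it is an annihilation operator, and to its left otherwise. -/
def addPsi (c : WithTop ℤ) (k : ℤ) : Op →ₗ[ℂ] Op :=
  if (k : WithTop ℤ) < c then LinearMap.mulRight ℂ (psi k) else LinearMap.mulLeft ℂ (psi k)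

/-- The map `:W:_c ↦ :ψ*_i W:_c` on normally ordered words of even length, where the letter `ψ*_i`
goes to the left of all of `W` if it is a creation operator, and to its right otherwise. -/
def addStar (c : WithTop ℤ) (i : ℤ) : Op →ₗ[ℂ] Op :=
  if (i : WithTop ℤ) < c then LinearMap.mulLeft ℂ (psiStar i)
  else LinearMap.mulRight ℂ (psiStar i)

/-- The map `:W:_c ↦ :ψ*_i ψ_k W:_c` on normally ordered words of even length. -/
def addPair (c : WithTop ℤ) (q : ℤ × ℤ) : Op →ₗ[ℂ] Op :=
  (if (q.1 : WithTop ℤ) < c then (1 : ℂ) else -1) • (addStar c q.1 ∘ₗ addPsi c q.2)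

/-- The map `:W:_c ↦ :ψ*_i ψ_k W:_c` on normally ordered words of odd length. -/
def addPairOdd (c : WithTop ℤ) (q : ℤ × ℤ) : Op →ₗ[ℂ] Op :=
  (if (q.2 : WithTop ℤ) < c then (-1 : ℂ) else 1) • (addStar c q.1 ∘ₗ addPsi c q.2)

/-- `X ↦ X ψ*_k - ψ*_k X`. -/
def commStar (k : ℤ) : Op →ₗ[ℂ] Op :=
  LinearMap.mulRight ℂ (psiStar k) - LinearMap.mulLeft ℂ (psiStar k)

/-- A letter `ψ*_k` is moved through a pair `ψ*_i ψ_j`, with one contraction. -/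
theorem commStar_addPair (k : ℤ) (q : ℤ × ℤ) (Z : Op) :
    commStar k (addPair c q Z) =
      addPairOdd c q (commStar k Z) + if q.2 = k then addStar c q.1 Z else 0 := by
  obtain ⟨i, j⟩ := q
  have e2 := psiStar_mul_psiStar i k
  rcases eq_or_ne j k with rfl | hjk
  on_goal 1 => have e1 := psi_mul_psiStar_self j
  on_goal 2 => have e1 := psi_mul_psiStar_of_ne hjk
  all_goals
    by_cases hi : (i : WithTop ℤ) < c <;> by_cases hj : (j : WithTop ℤ) < c <;>
    simp only [commStar, addPair, addPairOdd, addStar, addPsi, *, if_true, if_false,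
      LinearMap.smul_apply, LinearMap.comp_apply, LinearMap.sub_apply, LinearMap.mulLeft_apply,
      LinearMap.mulRight_apply, one_smul, neg_smul]
  · linear_combination (norm := noncomm_ring) psiStar i * Z * e1 - e2 * Z * psi j
  · linear_combination (norm := noncomm_ring) psiStar i * e1 * Z - e2 * psi j * Z
  · linear_combination (norm := noncomm_ring) Z * e1 * psiStar i - Z * psi j * e2
  · linear_combination (norm := noncomm_ring) e1 * Z * psiStar i - psi j * Z * e2
  · linear_combination (norm := noncomm_ring) psiStar i * Z * e1 - e2 * Z * psi j
  · linear_combination (norm := noncomm_ring) psiStar i * e1 * Z - e2 * psi j * Z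
  · linear_combination (norm := noncomm_ring) Z * e1 * psiStar i - Z * psi j * e2
  · linear_combination (norm := noncomm_ring) e1 * Z * psiStar i - psi j * Z * e2

/-- As `ψ*_i` is a single letter under the sign of normal ordering, it commutes with pairs. -/
theorem addPairOdd_addStar (q : ℤ × ℤ) (i : ℤ) (Z : Op) :
    addPairOdd c q (addStar c i Z) = addStar c i (addPair c q Z) := by
  obtain ⟨a, b⟩ := q
  have e2 := psiStar_mul_psiStar a i
  by_cases hi : (i : WithTop ℤ) < c <;> by_cases ha : (a : WithTop ℤ) < c <;>
    by_cases hb : (b : WithTop ℤ) < c <;>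
    simp only [addPair, addPairOdd, addStar, addPsi, hi, ha, hb, if_true, if_false,
      LinearMap.smul_apply, LinearMap.comp_apply, LinearMap.mulLeft_apply,
      LinearMap.mulRight_apply, one_smul, neg_smul]
  · linear_combination (norm := noncomm_ring) -e2 * Z * psi b
  · have e1 := psi_mul_psiStar_of_ne (j := b) (k := i) (by rintro rfl; exact hb hi)
    linear_combination (norm := noncomm_ring) psiStar a * e1 * Z - e2 * psi b * Z
  · noncomm_ring
  · have e1 := psi_mul_psiStar_of_ne (j := b) (k := i) (by rintro rfl; exact hb hi)
    linear_combination (norm := noncomm_ring) e1 * Z * psiStar a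
  · have e1 := psi_mul_psiStar_of_ne (j := b) (k := i) (by rintro rfl; exact hi hb)
    linear_combination (norm := noncomm_ring) - psiStar a * Z * e1
  · noncomm_ring
  · have e1 := psi_mul_psiStar_of_ne (j := b) (k := i) (by rintro rfl; exact hi hb)
    linear_combination (norm := noncomm_ring) Z * psi b * e2 - Z * e1 * psiStar a
  · linear_combination (norm := noncomm_ring) psi b * Z * e2

/-- The map `:W:_c ↦ :(∑_{i,k ∈ F} A_{ik} ψ*_i ψ_k) W:_c` on words of even length. -/
def addBilin (c : WithTop ℤ) (A : Matrix ℤ ℤ ℂ) (F : Finset ℤ) : Module.End ℂ Op :=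
  ∑ q ∈ F ×ˢ F, A q.1 q.2 • addPair c q

/-- The map `:W:_c ↦ :(∑_{i,k ∈ F} A_{ik} ψ*_i ψ_k) W:_c` on words of odd length. -/
def addBilinOdd (c : WithTop ℤ) (A : Matrix ℤ ℤ ℂ) (F : Finset ℤ) : Module.End ℂ Op :=
  ∑ q ∈ F ×ˢ F, A q.1 q.2 • addPairOdd c q

/-- The map `:W:_c ↦ :(∑_{i ∈ F} A_{ik} ψ*_i) W:_c` on words of even length. -/
def addCol (c : WithTop ℤ) (A : Matrix ℤ ℤ ℂ) (F : Finset ℤ) (k : ℤ) : Module.End ℂ Op :=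
  ∑ i ∈ F, A i k • addStar c i

variable {A : Matrix ℤ ℤ ℂ} {F : Finset ℤ} {k : ℤ}

theorem commStar_addBilin (hk : k ∈ F) (Z : Op) :
    commStar k (addBilin c A F Z) = addBilinOdd c A F (commStar k Z) + addCol c A F k Z := by
  simp only [addBilin, addBilinOdd, addCol, LinearMap.sum_apply, map_sum, LinearMap.smul_apply,
    map_smul, commStar_addPair, smul_add, Finset.sum_add_distrib]
  congr 1
  rw [Finset.sum_product]
  exact Finset.sum_congr rfl fun i _ => by simp [hk]

theorem addBilinOdd_addCol (Z : Op) :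
    addBilinOdd c A F (addCol c A F k Z) = addCol c A F k (addBilin c A F Z) := by
  simp only [addBilin, addBilinOdd, addCol, LinearMap.sum_apply, map_sum, LinearMap.smul_apply,
    map_smul, addPairOdd_addStar, Finset.smul_sum]
  refine Finset.sum_comm.trans (Finset.sum_congr rfl fun q _ => Finset.sum_congr rfl fun i _ => ?_)
  exact smul_comm _ _ _

/-- The power rule for the contraction with `ψ*_k`. -/
theorem commStar_pow_addBilin (hk : k ∈ F) (m : ℕ) :
    commStar k ((addBilin c A F ^ (m + 1)) 1) =
      ((m + 1 : ℕ) : ℂ) • addCol c A F k ((addBilin c A F ^ m) 1) := by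
  induction m with
  | zero =>
    have h1 : commStar k 1 = 0 := by simp [commStar]
    rw [zero_add, pow_one, commStar_addBilin hk, h1, map_zero, zero_add, pow_zero]
    simp
  | succ m ih =>
    rw [pow_succ', Module.End.mul_apply, commStar_addBilin hk, ih, map_smul, addBilinOdd_addCol,
      ← Module.End.mul_apply (addBilin c A F), ← pow_succ']
    push_cast
    module

theorem addPair_normalOrder {m : ℕ} (p : Fin (m + 1) → ℤ × ℤ) :
    addPair c (p 0) (normalOrder c (bilinearWord (Fin.tail p))) =
      normalOrder c (bilinearWord p) := by
  rw [bilinearWord_succ]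
  have hlen := length_bilinearWord (Fin.tail p)
  by_cases hi : ((p 0).1 : WithTop ℤ) < c <;> by_cases hk : ((p 0).2 : WithTop ℤ) < c
  · rw [normalOrder_cons_creation (f := .psiStar _) (by simpa [Letter.IsAnnihilation] using hi),
      normalOrder_cons_annihilation (f := .psi _) (by simpa [Letter.IsAnnihilation] using hk), hlen]
    simp [addPair, addStar, addPsi, hi, hk, Letter.op]
  · rw [normalOrder_cons_creation (f := .psiStar _) (by simpa [Letter.IsAnnihilation] using hi),
      normalOrder_cons_creation (f := .psi _) (by simpa [Letter.IsAnnihilation] using hk)]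
    simp [addPair, addStar, addPsi, hi, hk, Letter.op]
  · rw [normalOrder_cons_annihilation (f := .psiStar _)
        (by simpa [Letter.IsAnnihilation] using hi),
      normalOrder_cons_annihilation (f := .psi _) (by simpa [Letter.IsAnnihilation] using hk),
      List.length_cons, hlen, pow_succ]
    simp [addPair, addStar, addPsi, hi, hk, Letter.op]
  · rw [normalOrder_cons_annihilation (f := .psiStar _)
        (by simpa [Letter.IsAnnihilation] using hi),
      normalOrder_cons_creation (f := .psi _) (by simpa [Letter.IsAnnihilation] using hk),
      List.length_cons, hlen, pow_succ]
    simp [addPair, addStar, addPsi, hi, hk, Letter.op]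

theorem pow_addBilin_one (m : ℕ) :
    (addBilin c A F ^ m) 1 = ∑ p ∈ Fintype.piFinset fun _ : Fin m => F ×ˢ F,
      (∏ a, A (p a).1 (p a).2) • normalOrder c (bilinearWord p) := by
  induction m with
  | zero => simp [bilinearWord, normalOrder_nil]
  | succ m ih =>
    rw [pow_succ', Module.End.mul_apply, ih, addBilin, LinearMap.sum_apply]
    simp only [map_sum, LinearMap.smul_apply, map_smul]
    refine (Finset.sum_product' _ _ _).symm.trans ?_
    refine Finset.sum_nbij' (fun x => (Fin.cons x.1 x.2 : Fin (m + 1) → ℤ × ℤ))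
      (fun p => (p 0, Fin.tail p)) ?_ ?_ ?_ ?_ ?_
    · intro x hx
      rw [Finset.mem_product, Fintype.mem_piFinset] at hx
      exact Fintype.mem_piFinset.2 fun a => Fin.cases hx.1 hx.2 a
    · intro p hp
      rw [Fintype.mem_piFinset] at hp
      exact Finset.mem_product.2 ⟨hp 0, Fintype.mem_piFinset.2 fun a => hp a.succ⟩
    · intro x _; simp
    · intro p _; simp
    · intro x _
      have h := addPair_normalOrder (c := c) (Fin.cons x.1 x.2 : Fin (m + 1) → ℤ × ℤ)
      rw [Fin.cons_zero, Fin.tail_cons] at h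
      rw [← h, smul_smul, Fin.prod_univ_succ]
      simp only [Fin.cons_zero, Fin.cons_succ]
      rw [mul_comm]

/-- Among more than `#F` letters `ψ_k` with `k ∈ F`, one occurs twice. -/
theorem pow_addBilin_eq_zero {m : ℕ} (hm : F.card < m) : (addBilin c A F ^ m) 1 = 0 := by
  rw [pow_addBilin_one]
  refine Finset.sum_eq_zero fun p hp => ?_
  rw [normalOrder_eq_zero_of_not_nodup, smul_zero]
  intro h
  have h1 := Finset.card_le_card_of_injOn (s := Finset.univ) (t := F) (fun a => (p a).2)
    (fun a _ => (Finset.mem_product.1 (Fintype.mem_piFinset.1 hp a)).2)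
    (injective_of_nodup_bilinearWord h).injOn
  rw [Finset.card_univ, Fintype.card_fin] at h1
  omega

/-- The operator `:exp(∑_{i,k ∈ F} A_{ik} ψ*_i ψ_k):_c`. -/
def expOp (c : WithTop ℤ) (A : Matrix ℤ ℤ ℂ) (F : Finset ℤ) : Op :=
  ∑ m ∈ Finset.range (F.card + 1), ((m.factorial : ℂ))⁻¹ • (addBilin c A F ^ m) 1

theorem cutExp_eq_sum (S' S : Maya) : cutExp c A S' S F =
    ∑ m ∈ Finset.range (F.card + 1), ((m.factorial : ℂ))⁻¹ *
      ∑ p ∈ Fintype.piFinset fun _ : Fin m => F ×ˢ F,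
        (∏ a, A (p a).1 (p a).2) * matrixElement (normalOrder c (bilinearWord p)) S' S := by
  refine tsum_eq_sum fun m hm => ?_
  have h := congrArg (fun X => matrixElement X S' S)
    (pow_addBilin_one (c := c) (A := A) (F := F) m)
  rw [pow_addBilin_eq_zero (by simpa using hm)] at h
  simp only [matrixElement, LinearMap.sum_apply, Finsupp.finsetSum_apply, LinearMap.smul_apply,
    Finsupp.smul_apply, smul_eq_mul, LinearMap.zero_apply, Finsupp.zero_apply] at h
  simp only [matrixElement, ← h, mul_zero]

theorem cutExp_eq (S' S : Maya) : cutExp c A S' S F = matrixElement (expOp c A F) S' S := by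
  simp [cutExp_eq_sum, expOp, pow_addBilin_one, matrixElement, LinearMap.sum_apply,
    Finsupp.finsetSum_apply]

/-- The commutation of `X = :exp(∑ A_{ik} ψ*_i ψ_k):_c` with `ψ*_k`, before it is solved for
`X ψ*_k`. -/
theorem commStar_expOp (hk : k ∈ F) :
    commStar k (expOp c A F) = addCol c A F k (expOp c A F) := by
  have hz : addCol c A F k ((addBilin c A F ^ F.card) 1) = 0 := by
    have h := commStar_pow_addBilin (c := c) (A := A) hk F.card
    rw [pow_addBilin_eq_zero (Nat.lt_succ_self _), map_zero] at h
    exact (smul_eq_zero.1 h.symm).resolve_left (Nat.cast_ne_zero.2 (Nat.succ_ne_zero _))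
  simp only [expOp, map_sum, map_smul]
  rw [Finset.sum_range_succ', Finset.sum_range_succ _ F.card, hz]
  have h1 : commStar k ((addBilin c A F ^ 0) 1) = 0 := by simp [commStar]
  rw [h1, smul_zero, add_zero, smul_zero, add_zero]
  refine Finset.sum_congr rfl fun m _ => ?_
  rw [commStar_pow_addBilin hk, smul_smul, Nat.factorial_succ]
  congr 1
  have : ((m + 1 : ℕ) : ℂ) ≠ 0 := Nat.cast_ne_zero.2 (Nat.succ_ne_zero _)
  push_cast at this ⊢
  field_simp

end

section

/-! ### Modes in the vacuum state do not contribute -/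

variable {c : WithTop ℤ} {A : Matrix ℤ ℤ ℂ} {F : Finset ℤ} {k : ℤ}

theorem psi_apply_apply_of_notMem {S' : Maya} (h : k ∉ S'.modes) (v : Fock) : psi k v S' = 0 := by
  induction v using Finsupp.induction_linear with
  | zero => simp
  | add v w hv hw => rw [map_add, Finsupp.add_apply, hv, hw, add_zero]
  | single S a =>
    rw [← mul_one a, ← smul_eq_mul, ← Finsupp.smul_single, map_smul]
    by_cases hS : k ∈ S.modes
    · simp [psi_single_of_mem hS]
    · have : S.insert k ≠ S' := by rintro rfl; simp [Maya.mem_insert] at h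
      simp [psi_single_of_notMem hS, this]

theorem psiStar_apply_apply_of_mem {S' : Maya} (h : k ∈ S'.modes) (v : Fock) :
    psiStar k v S' = 0 := by
  induction v using Finsupp.induction_linear with
  | zero => simp
  | add v w hv hw => rw [map_add, Finsupp.add_apply, hv, hw, add_zero]
  | single S a =>
    rw [← mul_one a, ← smul_eq_mul, ← Finsupp.smul_single, map_smul]
    by_cases hS : k ∈ S.modes
    · have : S.erase k ≠ S' := by rintro rfl; simp [Maya.mem_erase] at h
      simp [psiStar_single_of_mem hS, this]
    · simp [psiStar_single_of_notMem hS]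

/-- A mode which is occupied in `S'` and in `S` as in the vacuum `|c⟩` does not contribute: any
letter of this mode annihilates the state `|S⟩` if it is an annihilation operator, and `⟨S'|` if it is a
creation operator. -/
theorem cutExp_eq_of_vacuum {F₀ : Finset ℤ} (hF : F₀ ⊆ F) {S' S : Maya}
    (h : ∀ k ∈ F, k ∉ F₀ → ((k : WithTop ℤ) < c → k ∈ S'.modes ∧ k ∈ S.modes) ∧
      (c ≤ (k : WithTop ℤ) → k ∉ S'.modes ∧ k ∉ S.modes)) :
    cutExp c A S' S F = cutExp c A S' S F₀ := by
  refine tsum_congr fun m => ?_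
  congr 1
  symm
  refine Finset.sum_subset (fun p hp => ?_) fun p hp hp0 => ?_
  · rw [Fintype.mem_piFinset] at hp ⊢
    exact fun a => Finset.product_subset_product hF hF (hp a)
  · rw [Fintype.mem_piFinset] at hp hp0
    push Not at hp0
    obtain ⟨a, ha⟩ := hp0
    obtain ⟨h1, h2⟩ := Finset.mem_product.1 (hp a)
    have key : matrixElement (normalOrder c (bilinearWord p)) S' S = 0 := by
      unfold matrixElement
      by_cases hi : (p a).1 ∈ F₀
      · have hk : (p a).2 ∉ F₀ := fun hk => ha (Finset.mem_product.2 ⟨hi, hk⟩)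
        have hm := psi_mem_bilinearWord p a
        by_cases hc : ((p a).2 : WithTop ℤ) < c
        · rw [normalOrder_apply_eq_zero hm hc (psi_single_of_mem ((h _ h2 hk).1 hc).2)]
          rfl
        · exact normalOrder_apply_apply_eq_zero hm hc
            (psi_apply_apply_of_notMem ((h _ h2 hk).2 (not_lt.1 hc)).1) _
      · have hm := psiStar_mem_bilinearWord p a
        by_cases hc : c ≤ ((p a).1 : WithTop ℤ)
        · rw [normalOrder_apply_eq_zero hm hc (psiStar_single_of_notMem ((h _ h1 hi).2 hc).2)]
          rfl
        · exact normalOrder_apply_apply_eq_zero hm hc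
            (psiStar_apply_apply_of_mem ((h _ h1 hi).1 (not_le.1 hc)).1) _
    rw [key, mul_zero]

theorem cutExp_empty (S : Maya) : cutExp c A S S ∅ = 1 := by
  rw [cutExp_eq]
  simp [expOp, matrixElement]

/-! ### Conservation of charge -/

/-- The span of the basis states that agree with `Ω` outside `F` and have `q` filled modes in
`F`. -/
def sector (F : Finset ℤ) (Ω : Maya) (q : ℤ) : Submodule ℂ Fock :=
  Finsupp.supported ℂ ℂ {S : Maya | (∀ k ∉ F, k ∈ S.modes ↔ k ∈ Ω.modes) ∧
    (({k : ℤ | k ∈ F ∧ k ∈ S.modes}.ncard : ℕ) : ℤ) = q}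

/-- The operators that change the number of filled modes in `F` by `d` and leave the modes outside
`F` as they are. -/
def HasCharge (F : Finset ℤ) (Ω : Maya) (d : ℤ) (X : Op) : Prop :=
  ∀ q, ∀ v ∈ sector F Ω q, X v ∈ sector F Ω (q + d)

variable {Ω : Maya} {d e : ℤ} {X Y Z : Op}

theorem HasCharge.of_single
    (h : ∀ S : Maya, (∀ k ∉ F, k ∈ S.modes ↔ k ∈ Ω.modes) → X (Finsupp.single S 1) ∈
      sector F Ω (({k : ℤ | k ∈ F ∧ k ∈ S.modes}.ncard : ℕ) + d)) : HasCharge F Ω d X := by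
  intro q v hv
  rw [sector, Finsupp.supported_eq_span_single] at hv
  induction hv using Submodule.span_induction with
  | mem v hv =>
    obtain ⟨S, ⟨hS, rfl⟩, rfl⟩ := hv
    exact h S hS
  | zero => rw [map_zero]; exact Submodule.zero_mem _
  | add v w _ _ hv hw => rw [map_add]; exact Submodule.add_mem _ hv hw
  | smul a v _ hv => rw [map_smul]; exact Submodule.smul_mem _ a hv

theorem single_mem_sector {S : Maya} (a : ℂ) (hS : ∀ k ∉ F, k ∈ S.modes ↔ k ∈ Ω.modes) {q : ℤ}
    (hq : (({k : ℤ | k ∈ F ∧ k ∈ S.modes}.ncard : ℕ) : ℤ) = q) :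
    a • Finsupp.single S 1 ∈ sector F Ω q :=
  Submodule.smul_mem _ a (Finsupp.single_mem_supported ℂ 1 ⟨hS, hq⟩)

theorem ncard_insert {S : Maya} (hk : k ∈ F) (hS : k ∉ S.modes) :
    {j : ℤ | j ∈ F ∧ j ∈ (S.insert k).modes}.ncard =
      {j : ℤ | j ∈ F ∧ j ∈ S.modes}.ncard + 1 := by
  have h1 : {j : ℤ | j ∈ F ∧ j ∈ (S.insert k).modes} =
      Insert.insert k {j : ℤ | j ∈ F ∧ j ∈ S.modes} := by
    ext j; simp only [Set.mem_ofPred_eq, Maya.mem_insert, Set.mem_insert_iff]; grind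
  rw [h1, Set.ncard_insert_of_notMem (fun h => hS h.2)
    (F.finite_toSet.subset fun j hj => hj.1)]

theorem hasCharge_psi (hk : k ∈ F) : HasCharge F Ω 1 (psi k) := by
  refine HasCharge.of_single fun S hS => ?_
  by_cases h : k ∈ S.modes
  · rw [psi_single_of_mem h]; exact Submodule.zero_mem _
  · rw [psi_single_of_notMem h]
    refine single_mem_sector _ (fun j hj => ?_) ?_
    · rw [Maya.mem_insert, ← hS j hj]; grind
    · rw [ncard_insert hk h]; push_cast; ring

theorem hasCharge_psiStar (hk : k ∈ F) : HasCharge F Ω (-1) (psiStar k) := by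
  refine HasCharge.of_single fun S hS => ?_
  by_cases h : k ∈ S.modes
  · rw [psiStar_single_of_mem h]
    refine single_mem_sector _ (fun j hj => ?_) ?_
    · rw [Maya.mem_erase, ← hS j hj]; grind
    · have h1 := ncard_insert (S := S.erase k) hk (by simp [Maya.mem_erase])
      rw [S.erase_insert h] at h1
      rw [h1]; push_cast; ring
  · rw [psiStar_single_of_notMem h]; exact Submodule.zero_mem _

theorem HasCharge.mul (hX : HasCharge F Ω d X) (hY : HasCharge F Ω e Y) :
    HasCharge F Ω (d + e) (X * Y) := by
  intro q v hv
  have := hX _ _ (hY _ _ hv)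
  rwa [add_assoc, add_comm e] at this

theorem HasCharge.smul (a : ℂ) (hX : HasCharge F Ω d X) : HasCharge F Ω d (a • X) :=
  fun q v hv => Submodule.smul_mem _ a (hX q v hv)

theorem HasCharge.sum {ι : Type*} {s : Finset ι} {f : ι → Op}
    (h : ∀ i ∈ s, HasCharge F Ω d (f i)) : HasCharge F Ω d (∑ i ∈ s, f i) := by
  intro q v hv
  rw [LinearMap.sum_apply]
  exact Submodule.sum_mem _ fun i hi => h i hi q v hv

theorem hasCharge_addPair {q : ℤ × ℤ} (hq : q ∈ F ×ˢ F) (hZ : HasCharge F Ω 0 Z) :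
    HasCharge F Ω 0 (addPair c q Z) := by
  obtain ⟨h1, h2⟩ := Finset.mem_product.1 hq
  have hp : HasCharge F Ω 1 (addPsi c q.2 Z) := by
    unfold addPsi
    split_ifs
    · exact hZ.mul (hasCharge_psi h2)
    · exact (hasCharge_psi h2).mul hZ
  refine HasCharge.smul _ ?_
  rw [LinearMap.comp_apply, addStar]
  split_ifs
  · exact (hasCharge_psiStar h1).mul hp
  · exact hp.mul (hasCharge_psiStar h1)

theorem hasCharge_addBilin (hZ : HasCharge F Ω 0 Z) : HasCharge F Ω 0 (addBilin c A F Z) := by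
  rw [addBilin, LinearMap.sum_apply]
  exact HasCharge.sum fun q hq => HasCharge.smul _ (hasCharge_addPair hq hZ)

theorem hasCharge_expOp : HasCharge F Ω 0 (expOp c A F) := by
  refine HasCharge.sum fun m _ => HasCharge.smul _ ?_
  clear * -
  induction m with
  | zero => intro q v hv; simpa using hv
  | succ m ih =>
    rw [pow_succ', Module.End.mul_apply]
    exact hasCharge_addBilin ih

open Classical in
/-- A state all of whose modes in `F` are filled is an eigenvector: it is the only one of its
charge. -/
theorem expOp_single_of_filled (hΩ : ∀ k ∈ F, k ∈ Ω.modes) :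
    expOp c A F (Finsupp.single Ω 1) = cutExp c A Ω Ω F • Finsupp.single Ω 1 := by
  have h1 : expOp c A F (Finsupp.single Ω 1) ∈ sector F Ω (F.card + 0) := by
    refine hasCharge_expOp _ _ ?_
    rw [← one_smul ℂ (Finsupp.single Ω 1)]
    refine single_mem_sector _ (fun _ _ => Iff.rfl) ?_
    have : {k : ℤ | k ∈ F ∧ k ∈ Ω.modes} = (F : Set ℤ) := by
      ext k; simpa using hΩ k
    rw [this, Set.ncard_coe_finset]
  ext S
  rw [cutExp_eq, matrixElement, Finsupp.smul_apply, Finsupp.single_apply]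
  split_ifs with h
  · rw [h, smul_eq_mul, mul_one]
  · rw [smul_zero]
    by_contra hne
    obtain ⟨h2, h3⟩ := h1 (Finsupp.mem_support_iff.2 hne)
    rw [add_zero, Nat.cast_inj] at h3
    have h4 : {k : ℤ | k ∈ F ∧ k ∈ S.modes} = (F : Set ℤ) :=
      Set.eq_of_subset_of_ncard_le (fun k hk => hk.1) (by rw [h3, Set.ncard_coe_finset])
        F.finite_toSet
    apply h
    refine (Maya.ext_modes ?_).symm
    ext k
    by_cases hk : k ∈ F
    · exact iff_of_true ((Set.ext_iff.1 h4 k).2 hk).2 (hΩ k hk)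
    · exact h2 k hk

end

section

/-! ### Comparison of the two vacua in finitely many modes -/

variable {c : WithTop ℤ} {A : Matrix ℤ ℤ ℂ} {F : Finset ℤ} {k : ℤ} {X Y : Op}

theorem Maya.exists_union (S : Maya) (F : Finset ℤ) :
    ∃ Ω : Maya, ∀ k, k ∈ Ω.modes ↔ k ∈ S.modes ∨ k ∈ F := by
  induction F using Finset.induction_on with
  | empty => exact ⟨S, by simp⟩
  | insert a F _ ih =>
    obtain ⟨Ω, hΩ⟩ := ih
    exact ⟨Ω.insert a, fun k => by rw [Maya.mem_insert, hΩ, Finset.mem_insert]; tauto⟩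

theorem Maya.exists_sdiff (S : Maya) (F : Finset ℤ) :
    ∃ V : Maya, ∀ k, k ∈ V.modes ↔ k ∈ S.modes ∧ k ∉ F := by
  induction F using Finset.induction_on with
  | empty => exact ⟨S, by simp⟩
  | insert a F _ ih =>
    obtain ⟨V, hV⟩ := ih
    exact ⟨V.erase a, fun k => by rw [Maya.mem_erase, hV, Finset.mem_insert]; tauto⟩

/-- An operator with known relations `X ψ*_k = ∑ M_{ik} ψ*_i X` is determined by its values on the
states in which all modes of `F` are filled, as the operators `ψ*_k` create all other states from
these. -/
theorem apply_single_eq_smul {M : Matrix ℤ ℤ ℂ}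
    (hX : ∀ k ∈ F, X * psiStar k = ∑ i ∈ F, M i k • (psiStar i * X))
    (hY : ∀ k ∈ F, Y * psiStar k = ∑ i ∈ F, M i k • (psiStar i * Y)) {x : ℂ} {Ω : Maya}
    (hΩ : X (Finsupp.single Ω 1) = x • Y (Finsupp.single Ω 1)) (S : Maya)
    (hS : ∀ k, k ∈ Ω.modes ↔ k ∈ S.modes ∨ k ∈ F) :
    X (Finsupp.single S 1) = x • Y (Finsupp.single S 1) := by
  classical
  induction h : (F.filter (· ∉ S.modes)).card generalizing S with
  | zero =>
    have : S = Ω := Maya.ext_modes (by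
      ext k
      rw [Finset.card_eq_zero, Finset.filter_eq_empty_iff] at h
      grind)
    rw [this, hΩ]
  | succ r ih =>
    obtain ⟨k, hk⟩ : (F.filter (· ∉ S.modes)).Nonempty := by
      rw [← Finset.card_pos]; omega
    obtain ⟨hkF, hkS⟩ := Finset.mem_filter.1 hk
    have h1 : X (Finsupp.single (S.insert k) 1) = x • Y (Finsupp.single (S.insert k) 1) := by
      refine ih _ (fun j => ?_) ?_
      · rw [hS, Maya.mem_insert]; grind
      · have : F.filter (· ∉ (S.insert k).modes) = (F.filter (· ∉ S.modes)).erase k := by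
          ext j; simp only [Finset.mem_filter, Finset.mem_erase, Maya.mem_insert]; grind
        rw [this, Finset.card_erase_of_mem hk, h]; rfl
    have h2 : (Finsupp.single S 1 : Fock) =
        S.sign k • psiStar k (Finsupp.single (S.insert k) 1) := by
      rw [psiStar_single_of_mem (by simp [Maya.mem_insert]), S.insert_erase hkS,
        S.sign_insert_self, smul_smul, S.sign_mul_self, one_smul]
    rw [h2, map_smul, map_smul, ← Module.End.mul_apply X, ← Module.End.mul_apply Y, hX k hkF,
      hY k hkF, smul_comm x (S.sign k)]
    congr 1
    simp only [LinearMap.sum_apply, LinearMap.smul_apply, Module.End.mul_apply, h1, map_smul,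
      Finset.smul_sum]
    exact Finset.sum_congr rfl fun i _ => smul_comm _ _ _

/-- For the bare vacuum, all `ψ*_i` are creation operators and stand to the left. -/
theorem expOp_top_mul_psiStar (hk : k ∈ F) :
    expOp ⊤ A F * psiStar k =
      ∑ i ∈ F, (1 + A : Matrix ℤ ℤ ℂ) i k • (psiStar i * expOp ⊤ A F) := by
  have h := commStar_expOp (c := ⊤) (A := A) hk
  simp only [commStar, LinearMap.sub_apply, LinearMap.mulLeft_apply, LinearMap.mulRight_apply,
    addCol, LinearMap.sum_apply, LinearMap.smul_apply, addStar, WithTop.coe_lt_top, if_true] at h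
  rw [sub_eq_iff_eq_add] at h
  rw [h]
  simp [Matrix.add_apply, add_smul, Finset.sum_add_distrib, Matrix.one_apply, hk, add_comm]

/-- The creation operators `∑_{i ∈ G} v_i ψ*_i` of the bare vacuum. -/
def starComb (G : Finset ℤ) : (G → ℂ) →ₗ[ℂ] Op :=
  Fintype.linearCombination ℂ fun i : G => psiStar i

theorem starComb_anticommute (G : Finset ℤ) (u v : G → ℂ) :
    starComb G u * starComb G v = -(starComb G v * starComb G u) := by
  simp only [starComb, Fintype.linearCombination_apply, Finset.sum_mul, Finset.mul_sum,
    ← Finset.sum_neg_distrib]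
  rw [Finset.sum_comm]
  refine Finset.sum_congr rfl fun i _ => Finset.sum_congr rfl fun j _ => ?_
  rw [smul_mul_smul_comm, smul_mul_smul_comm, psiStar_mul_psiStar, smul_neg, mul_comm]

theorem starComb_mul_self (G : Finset ℤ) (v : G → ℂ) : starComb G v * starComb G v = 0 := by
  have h := starComb_anticommute G v v
  rw [eq_neg_iff_add_eq_zero, ← two_smul ℂ] at h
  exact (smul_eq_zero.1 h).resolve_left two_ne_zero

/-- The matrix element `⟨S'| ψ*(v₁) ⋯ ψ*(v_r) |S⟩` is alternating in the vectors. -/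
def starAlternating (G : Finset ℤ) (r : ℕ) (S' S : Maya) : (G → ℂ) [⋀^Fin r]→ₗ[ℂ] ℂ where
  toMultilinearMap := ((Finsupp.lapply S' ∘ₗ LinearMap.applyₗ (Finsupp.single S 1 : Fock) :
      Op →ₗ[ℂ] ℂ).compMultilinearMap (MultilinearMap.mkPiAlgebraFin ℂ r Op)).compLinearMap
    fun _ => starComb G
  map_eq_zero_of_eq' v a b hab hne := by
    have h : (List.ofFn fun a => starComb G (v a)).prod = 0 := by
      refine prod_eq_zero_of_not_nodup ?_ ?_ ?_
      · simp only [List.mem_ofFn, forall_exists_index, forall_apply_eq_imp_iff]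
        exact fun _ _ => starComb_anticommute G _ _
      · simp only [List.mem_ofFn, forall_exists_index, forall_apply_eq_imp_iff]
        exact fun _ => starComb_mul_self G _
      · rw [List.nodup_ofFn]
        exact fun hinj => hne (hinj (by simp only [hab]))
    simp [h]

theorem starAlternating_apply (G : Finset ℤ) (r : ℕ) (S' S : Maya) (v : Fin r → G → ℂ) :
    starAlternating G r S' S v =
      matrixElement (List.ofFn fun a => starComb G (v a)).prod S' S := by
  simp [starAlternating, matrixElement]

theorem starComb_single {G : Finset ℤ} (i : G) : starComb G (Pi.single i 1) = psiStar i := by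
  classical
  simp [starComb, Fintype.linearCombination_apply_single]

theorem prod_psiStar_single {S : Maya} {l : List ℤ} (hl : l.Nodup) (hS : ∀ k ∈ l, k ∈ S.modes) :
    ∃ (ε : ℂ) (V : Maya), ε ≠ 0 ∧ (∀ k, k ∈ V.modes ↔ k ∈ S.modes ∧ k ∉ l) ∧
      (l.map psiStar).prod (Finsupp.single S 1) = ε • Finsupp.single V 1 := by
  induction l with
  | nil => exact ⟨1, S, one_ne_zero, by simp, by simp⟩
  | cons k l ih =>
    obtain ⟨ε, V, h0, hV, h⟩ := ih hl.of_cons fun j hj => hS j (by simp [hj])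
    have hk : k ∈ V.modes := (hV k).2 ⟨hS k (by simp), (List.nodup_cons.1 hl).1⟩
    refine ⟨ε * V.sign k, V.erase k, ?_, fun j => ?_, ?_⟩
    · refine mul_ne_zero h0 fun hz => ?_
      simpa [hz] using V.sign_mul_self k
    · rw [Maya.mem_erase, hV]; simp; tauto
    · rw [List.map_cons, List.prod_cons, Module.End.mul_apply, h, map_smul,
        psiStar_single_of_mem hk, smul_smul]

theorem mul_prod_psiStar {ι : Type*} {f : ι → ℤ} {g : ι → Op}
    (h : ∀ i, X * psiStar (f i) = g i * X) (l : List ι) :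
    X * (l.map fun i => psiStar (f i)).prod = (l.map g).prod * X := by
  induction l with
  | nil => simp
  | cons i l ih =>
    simp only [List.map_cons, List.prod_cons]
    rw [← mul_assoc, h, mul_assoc, ih, mul_assoc]

/-- The expectation value of `:exp(∑ B_{ik} ψ*_i ψ_k):_∞` in a state with no filled mode among
`G`. -/
theorem cutExp_top_of_empty {B : Matrix ℤ ℤ ℂ} {G : Finset ℤ} {V : Maya}
    (hV : ∀ k ∈ G, k ∉ V.modes) : cutExp ⊤ B V V G = cutDet (1 + B) G := by
  classical
  obtain ⟨Ω, hΩ⟩ := V.exists_union G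
  -- `Y` maps `|V⟩ = ± ∏ ψ*_k |Ω⟩` to `± ∏ ψ*(v_k) |Ω⟩`, where `v_k` is the column `k` of `1 + B`.
  set e : Fin G.card ≃ G := G.equivFin.symm with he
  set l : List ℤ := List.ofFn fun a => (e a : ℤ) with hl
  have hmem : ∀ k, k ∈ l ↔ k ∈ G := by
    intro k
    rw [hl, List.mem_ofFn]
    exact ⟨by rintro ⟨a, rfl⟩; exact (e a).2, fun hk => ⟨e.symm ⟨k, hk⟩, by simp⟩⟩
  obtain ⟨ε, V', h0, hV', hprod⟩ := prod_psiStar_single (S := Ω) (l := l)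
    (List.nodup_ofFn.2 (Subtype.val_injective.comp e.injective))
    fun k hk => (hΩ k).2 (Or.inr ((hmem k).1 hk))
  obtain rfl : V' = V := Maya.ext_modes (by ext k; rw [hV', hΩ, hmem]; grind)
  set Y := expOp ⊤ B G with hY
  set v : Fin G.card → G → ℂ := fun a i => (1 + B : Matrix ℤ ℤ ℂ) i (e a) with hv
  have hYstar : ∀ a, Y * psiStar (e a) = starComb G (v a) * Y := by
    intro a
    rw [hY, expOp_top_mul_psiStar (e a).2, starComb, Fintype.linearCombination_apply,
      Finset.sum_mul, ← Finset.sum_coe_sort G]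
    simp only [smul_mul_assoc, hv]
  have hYΩ : Y (Finsupp.single Ω 1) = Finsupp.single Ω 1 := by
    rw [hY, expOp_single_of_filled fun k hk => (hΩ k).2 (Or.inr hk),
      cutExp_eq_of_vacuum (Finset.empty_subset G), cutExp_empty, one_smul]
    exact fun k hk _ => ⟨fun _ => ⟨(hΩ k).2 (Or.inr hk), (hΩ k).2 (Or.inr hk)⟩, by simp⟩
  have hmain := mul_prod_psiStar hYstar (List.finRange G.card)
  have hl' : (List.finRange G.card).map (fun a => psiStar (e a)) = l.map psiStar := by
    rw [hl, List.map_ofFn, List.ofFn_eq_map]; rfl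
  rw [hl', ← List.ofFn_eq_map] at hmain
  have h1 : starAlternating G G.card V' Ω v = ε * cutExp ⊤ B V' V' G := by
    rw [starAlternating_apply, matrixElement, cutExp_eq, matrixElement, ← hY, ← smul_eq_mul,
      ← Finsupp.smul_apply, ← map_smul, ← hprod, ← Module.End.mul_apply, hmain,
      Module.End.mul_apply, hYΩ]
  set b := (Pi.basisFun ℂ G).reindex e.symm with hb
  have h2 : starAlternating G G.card V' Ω b = ε := by
    have : (List.ofFn fun a => starComb G (b a)) = l.map psiStar := by
      rw [hl, List.map_ofFn]
      congr 1
      funext a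
      rw [hb, Module.Basis.reindex_apply, Pi.basisFun_apply, starComb_single]
      rfl
    rw [starAlternating_apply, matrixElement, this, hprod]
    simp
  have h3 : b.det v = cutDet (1 + B) G := by
    rw [Module.Basis.det_apply, cutDet, ← Matrix.det_submatrix_equiv_self e]
    congr 1
  have h4 := congrArg (fun f => f v) ((starAlternating G G.card V' Ω).eq_smul_basis_det b)
  simp only [AlternatingMap.smul_apply, smul_eq_mul] at h4
  rw [h1, h2, h3] at h4
  exact mul_left_cancel₀ h0 h4

/-- The solution `u = v (1 + b)` of the linear equations `u - v = v (1 - p) a + u p a`, where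
`b - a = b p a`. It exists because `1 - p a` is invertible with inverse `1 + p b`. -/
theorem eq_vecMul_of_sub_eq {ι : Type*} [Fintype ι] [DecidableEq ι] {a b p : Matrix ι ι ℂ}
    (hab : b - a = b * p * a) {u v : ι → ℂ}
    (h : u - v = Matrix.vecMul v ((1 - p) * a) + Matrix.vecMul u (p * a)) :
    u = Matrix.vecMul v (1 + b) := by
  have h1 : (1 + p * b) * (1 - p * a) = 1 := by
    linear_combination (norm := noncomm_ring) p * hab
  have h2 : (1 - p * a) * (1 + p * b) = 1 := mul_eq_one_comm.1 h1
  have h3 : Matrix.vecMul u (1 - p * a) = Matrix.vecMul v (1 - p * a + a) := by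
    rw [Matrix.vecMul_sub, Matrix.vecMul_one, Matrix.vecMul_add, Matrix.vecMul_sub,
      Matrix.vecMul_one]
    rw [sub_mul, one_mul, Matrix.vecMul_sub] at h
    linear_combination h
  have h4 : a * (1 + p * b) = b := by
    have : a = b * (1 - p * a) := by linear_combination (norm := noncomm_ring) -hab
    rw [this, mul_assoc, h2, mul_one]
  calc u = Matrix.vecMul (Matrix.vecMul u (1 - p * a)) (1 + p * b) := by
        rw [Matrix.vecMul_vecMul, h2, Matrix.vecMul_one]
    _ = Matrix.vecMul v (1 + b) := by
        rw [h3, Matrix.vecMul_vecMul, add_mul, h2, h4]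

/-- The normally ordered exponents `:exp(A):_n` and `:exp(B):_∞` satisfy the same relation with
`ψ*_k`. -/
theorem expOp_mul_psiStar {n : ℤ} {A B : Matrix ℤ ℤ ℂ}
    (hAB : ∀ i ∈ F, ∀ k ∈ F, B i k - A i k = ∑ j ∈ F with n ≤ j, B i j * A j k) (hk : k ∈ F) :
    expOp n A F * psiStar k =
      ∑ i ∈ F, (1 + B : Matrix ℤ ℤ ℂ) i k • (psiStar i * expOp n A F) := by
  -- Matrix elements of the relations turn them into equations for row vectors of numbers.
  refine LinearMap.ext fun z => Finsupp.ext fun S => ?_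
  set X := expOp n A F with hX
  let u : F → ℂ := fun j => (X * psiStar j) z S
  let v : F → ℂ := fun j => (psiStar j * X) z S
  let a : Matrix F F ℂ := A.submatrix (↑) (↑)
  let b : Matrix F F ℂ := B.submatrix (↑) (↑)
  let p : Matrix F F ℂ := Matrix.diagonal fun j => if n ≤ (j : ℤ) then 1 else 0
  have hab : b - a = b * p * a := by
    ext i j
    rw [Matrix.mul_apply]
    simp only [a, b, p, Matrix.sub_apply, Matrix.submatrix_apply, Matrix.mul_diagonal,
      hAB i i.2 j j.2, Finset.sum_filter]
    rw [← Finset.sum_coe_sort F]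
    refine Finset.sum_congr rfl fun x _ => ?_
    split_ifs <;> simp
  have huv : u - v = Matrix.vecMul v ((1 - p) * a) + Matrix.vecMul u (p * a) := by
    ext j
    have h := congrArg (fun Z : Op => Z z S) (commStar_expOp (c := n) (A := A) j.2)
    simp only [commStar, addCol, LinearMap.sub_apply, LinearMap.sum_apply, LinearMap.smul_apply,
      LinearMap.mulLeft_apply, LinearMap.mulRight_apply, Op.sub_apply, Finsupp.add_apply,
      Finsupp.smul_apply, Finsupp.finsetSum_apply, ← hX] at h
    rw [← Finset.sum_coe_sort F] at h
    simp only [Matrix.vecMul, dotProduct, Pi.sub_apply, Pi.add_apply, ← Finset.sum_add_distrib,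
      sub_mul, one_mul, Matrix.sub_apply, p, Matrix.diagonal_mul]
    refine Eq.trans ?_ (h.trans (Finset.sum_congr rfl fun i _ => ?_))
    · simp [u, v, sub_eq_add_neg]
    · by_cases hi : n ≤ (i : ℤ)
      · simp [addStar, hi, not_lt.2 hi, u, a, mul_comm]
      · simp [addStar, hi, not_le.1 hi, v, a, mul_comm]
  have h := congrFun (eq_vecMul_of_sub_eq hab huv) ⟨k, hk⟩
  simp only [LinearMap.sum_apply, LinearMap.smul_apply, Finsupp.finsetSum_apply,
    Finsupp.smul_apply]
  rw [← Finset.sum_coe_sort F]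
  refine h.trans (Finset.sum_congr rfl fun i _ => ?_)
  simp [v, b, Matrix.one_apply, mul_comm, Subtype.ext_iff]

/-- The comparison of the vacua `|∞⟩` and `|n⟩` for matrices on a finite set of modes. -/
theorem cutExp_top_eq {n : ℤ} {A B : Matrix ℤ ℤ ℂ}
    (hAB : ∀ i ∈ F, ∀ k ∈ F, B i k - A i k = ∑ j ∈ F with n ≤ j, B i j * A j k) (S' S : Maya) :
    cutExp ⊤ B S' S F = cutDet (1 + B) (F.filter (n ≤ ·)) * cutExp n A S' S F := by
  set G := F.filter (n ≤ ·) with hG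
  -- In `Ω` all modes of `F` are filled, in `V` those below `n`.
  obtain ⟨Ω, hΩ⟩ := S.exists_union F
  obtain ⟨V, hV⟩ := Ω.exists_sdiff G
  have hΩF : ∀ k ∈ F, k ∈ Ω.modes := fun k hk => (hΩ k).2 (Or.inr hk)
  have hYΩ : expOp ⊤ B F (Finsupp.single Ω 1) = Finsupp.single Ω 1 := by
    rw [expOp_single_of_filled hΩF, cutExp_eq_of_vacuum (Finset.empty_subset F), cutExp_empty,
      one_smul]
    exact fun k hk _ => ⟨fun _ => ⟨hΩF k hk, hΩF k hk⟩, by simp⟩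
  have hx : expOp n A F (Finsupp.single Ω 1) =
      cutExp n A Ω Ω F • expOp ⊤ B F (Finsupp.single Ω 1) := by
    rw [hYΩ, expOp_single_of_filled hΩF]
  set x := cutExp n A Ω Ω F
  have key : ∀ T : Maya, (∀ k, k ∈ Ω.modes ↔ k ∈ T.modes ∨ k ∈ F) → ∀ T' : Maya,
      cutExp n A T' T F = x * cutExp ⊤ B T' T F := by
    intro T hT T'
    rw [cutExp_eq, cutExp_eq, matrixElement, matrixElement,
      apply_single_eq_smul (fun k hk => expOp_mul_psiStar hAB hk)
        (fun k hk => expOp_top_mul_psiStar hk) hx T hT]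
    rfl
  have h1 := key V (fun k => by grind) V
  have h2 : cutExp n A V V F = 1 := by
    rw [cutExp_eq_of_vacuum (Finset.empty_subset F), cutExp_empty]
    intro k hk _
    simp only [WithTop.coe_lt_coe, WithTop.coe_le_coe]
    grind
  have h3 : cutExp ⊤ B V V F = cutDet (1 + B) G := by
    have hvac : ∀ k ∈ F, k ∉ G → ((k : WithTop ℤ) < ⊤ → k ∈ V.modes ∧ k ∈ V.modes) ∧
        (⊤ ≤ (k : WithTop ℤ) → k ∉ V.modes ∧ k ∉ V.modes) := by
      intro k hk hkG
      simp only [top_le_iff, WithTop.coe_ne_top, false_imp_iff, and_true, and_self]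
      grind
    rw [cutExp_eq_of_vacuum (Finset.filter_subset _ F) hvac,
      cutExp_top_of_empty fun k hk => by grind]
  rw [h2, h3] at h1
  rw [key S hΩ S', ← mul_assoc, mul_comm (cutDet _ _), ← h1, one_mul]

end

section

/-! ### Finite sections of compact operators on `ℓ²` -/

open Filter Topology

variable {ι : Type*} [DecidableEq ι]

/-- The coordinate projection of `ℓ²(ι)` onto the span of the basis vectors in `G`. -/
def coordProj (G : Finset ι) : lp (fun _ : ι => ℂ) 2 →L[ℂ] lp (fun _ : ι => ℂ) 2 :=
  ∑ i ∈ G, (lp.singleContinuousLinearMap ℂ (fun _ : ι => ℂ) 2 i).comp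
    (lp.evalCLM ℂ (fun _ : ι => ℂ) 2 i)

theorem coordProj_eq_sum (G : Finset ι) (x : lp (fun _ : ι => ℂ) 2) :
    coordProj G x = ∑ i ∈ G, lp.single 2 i (x i) := by
  simp [coordProj]
  rfl

theorem coordProj_apply (G : Finset ι) (x : lp (fun _ : ι => ℂ) 2) (j : ι) :
    coordProj G x j = if j ∈ G then x j else 0 := by
  rw [coordProj_eq_sum, lp.coeFn_sum, Finset.sum_apply]
  simp [Pi.single_apply]

theorem norm_coordProj_apply_le (G : Finset ι) (x : lp (fun _ : ι => ℂ) 2) :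
    ‖coordProj G x‖ ≤ ‖x‖ := by
  have h2 : (0 : ℝ) < (2 : ENNReal).toReal := by norm_num
  have h := lp.norm_sum_single h2 (fun i => x i) G
  rw [← coordProj_eq_sum] at h
  have h' := lp.sum_rpow_le_norm_rpow h2 x G
  rw [← h] at h'
  exact (Real.rpow_le_rpow_iff (norm_nonneg _) (norm_nonneg _) h2).1 h'

theorem norm_coordProj_le (G : Finset ι) : ‖coordProj G‖ ≤ 1 :=
  ContinuousLinearMap.opNorm_le_bound _ zero_le_one fun x => by
    simpa using norm_coordProj_apply_le G x

theorem tendsto_coordProj_apply (x : lp (fun _ : ι => ℂ) 2) :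
    Tendsto (fun G => coordProj G x) atTop (𝓝 x) := by
  simp only [coordProj_eq_sum]
  exact lp.hasSum_single (by norm_num) x

variable {K : lp (fun _ : ι => ℂ) 2 →L[ℂ] lp (fun _ : ι => ℂ) 2}

/-- The strong convergence of the coordinate projections to the identity is uniform on the
relatively compact image of the unit ball under `K`. -/
theorem tendsto_coordProj_mul (hK : IsCompactOperator K) :
    Tendsto (fun G => coordProj G * K) atTop (𝓝 K) := by
  rw [tendsto_iff_norm_sub_tendsto_zero, Metric.tendsto_nhds]
  intro ε hε
  obtain ⟨t, ht, hcov⟩ := Metric.totallyBounded_iff.1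
    (hK.isCompact_closure_image_closedBall 1).totallyBounded (ε / 4) (by positivity)
  have hev : ∀ᶠ G : Finset ι in atTop, ∀ y ∈ t, ‖coordProj G y - y‖ < ε / 4 := by
    rw [Filter.eventually_all_finite ht]
    intro y _
    have := tendsto_iff_norm_sub_tendsto_zero.1 (tendsto_coordProj_apply y)
    exact this.eventually (gt_mem_nhds (by positivity))
  filter_upwards [hev] with G hG
  rw [Real.dist_0_eq_abs, abs_norm]
  refine lt_of_le_of_lt (ContinuousLinearMap.opNorm_le_of_unit_norm (C := 3 * ε / 4)
    (by positivity) fun x hx => ?_) (by linarith)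
  obtain ⟨y, hy, hxy⟩ := Set.mem_iUnion₂.1
    (hcov (subset_closure ⟨x, by simp [hx], rfl⟩))
  rw [Metric.mem_ball, dist_eq_norm] at hxy
  have h1 : (coordProj G * K - K) x = coordProj G (K x - y) + (coordProj G y - y) - (K x - y) := by
    rw [map_sub]; simp
  rw [h1]
  calc _ ≤ ‖coordProj G (K x - y)‖ + ‖coordProj G y - y‖ + ‖K x - y‖ :=
        (norm_sub_le _ _).trans (by gcongr; exact norm_add_le _ _)
    _ ≤ ε / 4 + ε / 4 + ε / 4 := by
        gcongr
        · exact (norm_coordProj_apply_le _ _).trans hxy.le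
        · exact (hG y hy).le
        · exact hxy.le
    _ = 3 * ε / 4 := by ring

theorem tendsto_one_add_coordProj_mul (hK : IsCompactOperator K) :
    Tendsto (fun G => 1 + coordProj G * K) atTop (𝓝 (1 + K)) :=
  (tendsto_coordProj_mul hK).const_add 1

theorem eventually_isUnit_section (hK : IsCompactOperator K) (hu : IsUnit (1 + K)) :
    ∀ᶠ G : Finset ι in atTop, IsUnit (1 + coordProj G * K) :=
  (tendsto_one_add_coordProj_mul hK).eventually (Units.isOpen.mem_nhds hu)

theorem tendsto_inverse_section (hK : IsCompactOperator K) (hu : IsUnit (1 + K)) :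
    Tendsto (fun G => Ring.inverse (1 + coordProj G * K)) atTop (𝓝 (Ring.inverse (1 + K))) := by
  obtain ⟨u, hu⟩ := hu
  rw [← hu]
  exact (NormedRing.inverse_continuousAt u).tendsto.comp
    (hu ▸ tendsto_one_add_coordProj_mul hK)

theorem inverse_section_apply_eq_zero {G : Finset ι} (hu : IsUnit (1 + coordProj G * K))
    {x : lp (fun _ : ι => ℂ) 2} {j : ι} (hj : j ∉ G) (hx : x j = 0) :
    Ring.inverse (1 + coordProj G * K) x j = 0 := by
  have h := congrArg (fun T => T x j) (Ring.mul_inverse_cancel _ hu)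
  simpa [add_mul, coordProj_apply, hj, hx] using h

theorem section_inverse_apply {G : Finset ι} (hu : IsUnit (1 + coordProj G * K))
    (x : lp (fun _ : ι => ℂ) 2) {j : ι} (hj : j ∈ G) :
    (1 + K) (Ring.inverse (1 + coordProj G * K) x) j = x j := by
  have h := congrArg (fun T => T x j) (Ring.mul_inverse_cancel _ hu)
  simpa [add_mul, coordProj_apply, hj] using h

theorem apply_eq_sum_of_support {G : Finset ι} {x : lp (fun _ : ι => ℂ) 2}
    (hx : ∀ j ∉ G, x j = 0) : x = ∑ i ∈ G, x i • lp.single 2 i (1 : ℂ) := by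
  have h1 : coordProj G x = x := by
    refine lp.ext (funext fun j => ?_)
    rw [coordProj_apply]
    split_ifs with h
    · rfl
    · exact (hx j h).symm
  have h2 := coordProj_eq_sum G x
  rw [h1] at h2
  nth_rw 1 [h2]
  refine Finset.sum_congr rfl fun i _ => ?_
  rw [← lp.single_smul, smul_eq_mul, mul_one]

/-- The principal minor with rows and columns in `G` of the matrix of an operator on `ℓ²`. -/
def opMinor (T : lp (fun _ : ι => ℂ) 2 →L[ℂ] lp (fun _ : ι => ℂ) 2) (G : Finset ι) : ℂ :=
  (Matrix.of fun j k : G => T (lp.single 2 (k : ι) (1 : ℂ)) j).det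

theorem continuous_opMinor (G : Finset ι) :
    Continuous fun T : lp (fun _ : ι => ℂ) 2 →L[ℂ] lp (fun _ : ι => ℂ) 2 => opMinor T G := by
  refine Continuous.matrix_det (continuous_matrix fun j k => ?_)
  exact (lp.evalCLM ℂ (fun _ : ι => ℂ) 2 (j : ι)).continuous.comp
    (continuous_id.clm_apply continuous_const)

theorem continuousAt_opMinor_inverse {T : lp (fun _ : ι => ℂ) 2 →L[ℂ] lp (fun _ : ι => ℂ) 2}
    (hT : IsUnit T) (G : Finset ι) : ContinuousAt (fun T => opMinor (Ring.inverse T) G) T := by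
  obtain ⟨u, rfl⟩ := hT
  exact ((continuous_opMinor G).tendsto _).comp (NormedRing.inverse_continuousAt u).tendsto

/-- Jacobi's identity for complementary minors of `(1 + K)` restricted to `G ∪ T` and of its
inverse. -/
theorem opMinor_jacobi {G T : Finset ι} (hd : Disjoint G T)
    (hu : IsUnit (1 + coordProj (G ∪ T) * K)) :
    opMinor (1 + K) T =
      opMinor (1 + K) (G ∪ T) * opMinor (Ring.inverse (1 + coordProj (G ∪ T) * K)) G := by
  set R := Ring.inverse (1 + coordProj (G ∪ T) * K) with hR
  let e : G ⊕ T ≃ (G ∪ T : Finset ι) := Equiv.Finset.union G T hd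
  have he1 : ∀ j : G, (e (Sum.inl j) : ι) = j := fun j => rfl
  have he2 : ∀ j : T, (e (Sum.inr j) : ι) = j := fun j => rfl
  let mat : (lp (fun _ : ι => ℂ) 2 →L[ℂ] lp (fun _ : ι => ℂ) 2) → Matrix (G ⊕ T) (G ⊕ T) ℂ :=
    fun X => Matrix.of fun j k => X (lp.single 2 (e k : ι) (1 : ℂ)) (e j)
  have hMN : mat (1 + K) * mat R = 1 := by
    ext j k
    have hsup : ∀ i ∉ G ∪ T, R (lp.single 2 (e k : ι) (1 : ℂ)) i = 0 := fun i hi =>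
      inverse_section_apply_eq_zero hu hi
        (lp.single_apply_ne _ _ _ fun h => hi (by rw [h]; exact (e k).2))
    have h := section_inverse_apply hu (lp.single 2 (e k : ι) (1 : ℂ)) (e j).2
    rw [← hR, apply_eq_sum_of_support hsup, map_sum, lp.coeFn_sum, Finset.sum_apply,
      ← Finset.sum_coe_sort (G ∪ T), ← e.sum_comp] at h
    rw [Matrix.mul_apply]
    refine (Finset.sum_congr rfl fun x _ => ?_).trans (h.trans ?_)
    · simp only [mat, Matrix.of_apply, map_smul, lp.coeFn_smul, Pi.smul_apply, smul_eq_mul]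
      ring
    · rcases eq_or_ne j k with rfl | hjk
      · rw [lp.single_apply_self, Matrix.one_apply_eq]
      · rw [lp.single_apply_ne _ _ _ fun h => hjk (e.injective (Subtype.ext h)),
          Matrix.one_apply_ne hjk]
  rw [← Matrix.fromBlocks_toBlocks (mat (1 + K)), ← Matrix.fromBlocks_toBlocks (mat R),
    Matrix.fromBlocks_multiply, ← Matrix.fromBlocks_one, Matrix.fromBlocks_inj] at hMN
  obtain ⟨h11, _, h21, _⟩ := hMN
  have hprod : mat (1 + K) * Matrix.fromBlocks (mat R).toBlocks₁₁ 0 (mat R).toBlocks₂₁ 1 =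
      Matrix.fromBlocks 1 (mat (1 + K)).toBlocks₁₂ 0 (mat (1 + K)).toBlocks₂₂ := by
    nth_rw 1 [← Matrix.fromBlocks_toBlocks (mat (1 + K))]
    rw [Matrix.fromBlocks_multiply, h11, h21]
    simp
  have hdet := congrArg Matrix.det hprod
  rw [Matrix.det_mul, Matrix.det_fromBlocks_zero₁₂, Matrix.det_fromBlocks_zero₂₁, Matrix.det_one,
    Matrix.det_one, one_mul, mul_one] at hdet
  have hM : (mat (1 + K)).det = opMinor (1 + K) (G ∪ T) := by
    rw [opMinor, ← Matrix.det_submatrix_equiv_self e]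
    rfl
  rw [hM] at hdet
  exact hdet.symm

theorem opMinor_section_inverse {G : Finset ι} (hu : IsUnit (1 + coordProj G * K)) :
    opMinor (1 + K) G * opMinor (Ring.inverse (1 + coordProj G * K)) G = 1 := by
  have h := opMinor_jacobi (Finset.disjoint_empty_right G) (K := K) (by simpa using hu)
  rw [Finset.union_empty] at h
  rw [← h]
  simp [opMinor]

theorem section_sub_section {G G₁ T : Finset ι} (hT : Disjoint (G ∪ G₁) T) :
    1 + coordProj (G ∪ T) * K - (1 + coordProj G * K) = coordProj T * (K - coordProj G₁ * K) := by
  refine ContinuousLinearMap.ext fun x => lp.ext (funext fun j => ?_)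
  rw [add_sub_add_left_eq_sub]
  simp only [sub_apply, mul_apply_eq_comp, lp.coeFn_sub,
    Pi.sub_apply, coordProj_apply]
  by_cases hj : j ∈ T
  · have := Finset.disjoint_right.1 hT hj
    simp only [Finset.mem_union, not_or] at this
    simp [hj, this.1, this.2]
  · simp [hj]

/-- If the minors of `1 + K` converge to a nonzero limit, then the minors far out are close to `1`:
such a minor is the quotient of the minor on `G ∪ T` by the one on `G`, up to a correction that
vanishes as `T` moves out, since `K` is compact. -/
theorem eventually_opMinor_tail (hK : IsCompactOperator K) (hu : IsUnit (1 + K)) {d : ℂ}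
    (hd : Tendsto (opMinor (1 + K)) atTop (𝓝 d)) (hd0 : d ≠ 0) {ε : ℝ} (hε : 0 < ε) :
    ∃ G₁ : Finset ι, ∀ T, Disjoint G₁ T → ‖opMinor (1 + K) T - 1‖ < ε := by
  -- On a ball around `(d, d⁻¹)` the product stays within `ε` of `1`.
  have hmul : ∀ᶠ z : ℂ × ℂ in 𝓝 (d, d⁻¹), ‖z.1 * z.2 - 1‖ < ε := by
    have hc : ContinuousAt (fun z : ℂ × ℂ => ‖z.1 * z.2 - 1‖) (d, d⁻¹) := by fun_prop
    refine hc.eventually (gt_mem_nhds ?_)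
    simpa [mul_inv_cancel₀ hd0] using hε
  rw [nhds_prod_eq] at hmul
  obtain ⟨U, hU, V, hV, hUV⟩ := Filter.mem_prod_iff.1 hmul
  have hdi : Tendsto (fun G => (opMinor (1 + K) G)⁻¹) atTop (𝓝 d⁻¹) := hd.inv₀ hd0
  obtain ⟨G, hGU, hGV, hGu⟩ : ∃ G : Finset ι, (∀ G' ≥ G, opMinor (1 + K) G' ∈ U) ∧
      (V ∈ 𝓝 (opMinor (1 + K) G)⁻¹) ∧ IsUnit (1 + coordProj G * K) := by
    obtain ⟨G₀, hG₀⟩ := eventually_atTop.1 (hd hU)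
    obtain ⟨G₂, hG₂⟩ := eventually_atTop.1
      ((hdi.eventually (eventually_mem_nhds_iff.2 hV)).and (eventually_isUnit_section hK hu))
    refine ⟨G₀ ∪ G₂, fun G' hG' => hG₀ _ (Finset.subset_union_left.trans hG'), ?_, ?_⟩
    · exact (hG₂ (G₀ ∪ G₂) Finset.subset_union_right).1
    · exact (hG₂ (G₀ ∪ G₂) Finset.subset_union_right).2
  have hinv : opMinor (Ring.inverse (1 + coordProj G * K)) G = (opMinor (1 + K) G)⁻¹ :=
    eq_inv_of_mul_eq_one_right (opMinor_section_inverse hGu)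
  have hcont := continuousAt_opMinor_inverse hGu G
  have hev : ∀ᶠ T in 𝓝 (1 + coordProj G * K), opMinor (Ring.inverse T) G ∈ V ∧ IsUnit T := by
    refine (hcont.eventually ?_).and (Units.isOpen.mem_nhds hGu)
    change V ∈ 𝓝 (opMinor (Ring.inverse (1 + coordProj G * K)) G)
    rwa [hinv]
  obtain ⟨δ, hδ, hball⟩ := Metric.eventually_nhds_iff.1 hev
  obtain ⟨G₁, hG₁⟩ := eventually_atTop.1
    ((tendsto_coordProj_mul hK).eventually (Metric.ball_mem_nhds K hδ))
  have hdist : ‖K - coordProj G₁ * K‖ < δ := by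
    rw [← dist_eq_norm, dist_comm]
    exact hG₁ G₁ (le_refl G₁)
  refine ⟨G ∪ G₁, fun T hT => ?_⟩
  have hdT : Disjoint G T := hT.mono_left Finset.subset_union_left
  have hnorm : dist (1 + coordProj (G ∪ T) * K) (1 + coordProj G * K) < δ := by
    rw [dist_eq_norm, section_sub_section hT]
    refine (norm_mul_le _ _).trans_lt (lt_of_le_of_lt ?_ hdist)
    exact mul_le_of_le_one_left (norm_nonneg _) (norm_coordProj_le T)
  obtain ⟨hV', hunit⟩ := hball hnorm
  rw [opMinor_jacobi hdT hunit]
  have hmem := hUV (Set.mk_mem_prod (hGU (G ∪ T) Finset.subset_union_left) hV')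
  exact hmem

/-- If the principal minors of `1 + K` converge to `d ≠ 0`, then those of `(1 + K)⁻¹` converge to
`d⁻¹`. -/
theorem tendsto_opMinor_inverse (hK : IsCompactOperator K) (hu : IsUnit (1 + K)) {d : ℂ}
    (hd : Tendsto (opMinor (1 + K)) atTop (𝓝 d)) (hd0 : d ≠ 0) :
    Tendsto (opMinor (Ring.inverse (1 + K))) atTop (𝓝 d⁻¹) := by
  suffices h : Tendsto (fun G => d * opMinor (Ring.inverse (1 + K)) G) atTop (𝓝 1) by
    simpa [hd0] using h.const_mul d⁻¹
  rw [Metric.tendsto_nhds]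
  intro ε hε
  obtain ⟨G₁, hG₁⟩ := eventually_opMinor_tail hK hu hd hd0 (half_pos hε)
  filter_upwards [eventually_ge_atTop G₁] with G hG
  have hlim : Tendsto (fun G' : Finset ι => opMinor (1 + K) G' *
      opMinor (Ring.inverse (1 + coordProj G' * K)) G) atTop
      (𝓝 (d * opMinor (Ring.inverse (1 + K)) G)) :=
    hd.mul (((continuous_opMinor G).tendsto _).comp (tendsto_inverse_section hK hu))
  refine lt_of_le_of_lt (le_of_tendsto (hlim.dist tendsto_const_nhds) ?_) (half_lt_self hε)
  filter_upwards [eventually_ge_atTop G, eventually_isUnit_section hK hu] with G' hG' hunit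
  have h := opMinor_jacobi (K := K) (Finset.disjoint_sdiff (s := G) (t := G'))
  rw [Finset.union_sdiff_of_subset hG'] at h
  rw [← h hunit, dist_eq_norm]
  exact (hG₁ _ (Finset.disjoint_sdiff.mono_left hG)).le

end

section

/-! ### Infinite matrices -/

open Filter Topology

theorem infMul_apply_of_hasSum {X Y : Matrix ℤ ℤ ℂ} {i k : ℤ} {s : ℂ}
    (h : HasSum (fun j => X i j * Y j k) s) : infMul X Y i k = s :=
  h.tsum_eq

theorem hasSum_single_row {i : ℤ} (y : ℤ → ℂ) :
    HasSum (fun j => (1 : Matrix ℤ ℤ ℂ) i j * y j) (y i) := by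
  convert hasSum_single i fun j hj => ?_ using 1
  · simp
  · simp [Matrix.one_apply_ne hj.symm]

theorem hasSum_single_col {k : ℤ} (x : ℤ → ℂ) :
    HasSum (fun j => x j * (1 : Matrix ℤ ℤ ℂ) j k) (x k) := by
  convert hasSum_single k fun j hj => ?_ using 1
  · simp
  · simp [Matrix.one_apply_ne hj]

theorem infMul_one_add {X Y : Matrix ℤ ℤ ℂ} {i k : ℤ} {s : ℂ}
    (h : HasSum (fun j => X i j * Y j k) s) : infMul X (1 + Y) i k = X i k + s := by
  refine infMul_apply_of_hasSum ?_
  simpa only [Matrix.add_apply, mul_add] using (hasSum_single_col (k := k) (X i)).add h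

theorem one_add_infMul {X Y : Matrix ℤ ℤ ℂ} {i k : ℤ} {s : ℂ}
    (h : HasSum (fun j => X i j * Y j k) s) : infMul (1 + X) Y i k = Y i k + s := by
  refine infMul_apply_of_hasSum ?_
  simpa only [Matrix.add_apply, add_mul] using (hasSum_single_row (i := i) fun j => Y j k).add h

theorem one_add_infMul_one_add {X Y : Matrix ℤ ℤ ℂ}
    (h : ∀ i k, HasSum (fun j => X i j * Y j k) (-(X i k + Y i k))) :
    infMul (1 + X) (1 + Y) = 1 := by
  ext i k
  have h1 := (hasSum_single_row (i := i) fun j => (1 + Y : Matrix ℤ ℤ ℂ) j k).add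
    ((hasSum_single_col (k := k) (X i)).add (h i k))
  simp only [← mul_add, ← add_mul, ← Matrix.add_apply] at h1
  rw [infMul_apply_of_hasSum h1]
  simp only [Matrix.add_apply]
  ring

theorem proj_infMul (n : ℤ) (X : Matrix ℤ ℤ ℂ) (i k : ℤ) :
    infMul (proj n) X i k = if n ≤ i then X i k else 0 := by
  refine infMul_apply_of_hasSum ?_
  convert hasSum_single i fun j hj => ?_ using 1
  · simp [proj]
  · simp [proj, Matrix.diagonal_apply_ne _ hj.symm]

theorem infMul_proj (n : ℤ) (X : Matrix ℤ ℤ ℂ) (i k : ℤ) :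
    infMul X (proj n) i k = if n ≤ k then X i k else 0 := by
  refine infMul_apply_of_hasSum ?_
  convert hasSum_single k fun j hj => ?_ using 1
  · simp [proj]
  · simp [proj, Matrix.diagonal_apply_ne _ hj]

theorem hasSum_Ici_iff {n : ℤ} {f : ℤ → ℂ} {s : ℂ} :
    HasSum (fun j : Set.Ici n => f j) s ↔ HasSum (fun j => if n ≤ j then f j else 0) s := by
  have h := hasSum_subtype_iff_indicator (f := f) (a := s) (s := Set.Ici n)
  refine h.trans (iff_of_eq ?_)
  congr 1
  ext j
  simp [Set.indicator_apply]

theorem hasSum_of_eq {α : Type*} {f g : α → ℂ} {s t : ℂ} (h : HasSum f s)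
    (hf : ∀ j, g j = f j) (hs : t = s) :
    HasSum g t := by
  rwa [hs, funext hf]

variable {n : ℤ} {A B : Matrix ℤ ℤ ℂ}

/-- If `A P B = B P A = B - A`, then `1 - P A` is the inverse of `1 + P B`. -/
theorem areInverse_one_add_proj_infMul
    (hl : ∀ i k, HasSum (fun j : Set.Ici n => A i j * B j k) (B i k - A i k))
    (hr : ∀ i k, HasSum (fun j : Set.Ici n => B i j * A j k) (B i k - A i k)) :
    AreInverse (1 + infMul (proj n) B) (1 + -infMul (proj n) A) := by
  refine ⟨one_add_infMul_one_add fun i k => ?_, one_add_infMul_one_add fun i k => ?_⟩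
  · have h := (hasSum_Ici_iff (f := fun j => B i j * A j k)).1 (hr i k)
    simp only [Matrix.neg_apply, proj_infMul]
    by_cases hi : n ≤ i
    · exact hasSum_of_eq h.neg (fun j => by split_ifs <;> simp)
        (by simp only [hi, if_true]; ring)
    · exact hasSum_of_eq hasSum_zero (fun j => by simp [hi]) (by simp [hi])
  · have h := (hasSum_Ici_iff (f := fun j => A i j * B j k)).1 (hl i k)
    simp only [Matrix.neg_apply, proj_infMul]
    by_cases hi : n ≤ i
    · exact hasSum_of_eq h.neg (fun j => by split_ifs <;> simp)
        (by simp only [hi, if_true]; ring)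
    · exact hasSum_of_eq hasSum_zero (fun j => by simp [hi]) (by simp [hi])

/-- If `A P B = B P A = B - A`, then `1 + B P` is the inverse of `1 - A P`. -/
theorem areInverse_one_sub_infMul_proj
    (hl : ∀ i k, HasSum (fun j : Set.Ici n => A i j * B j k) (B i k - A i k))
    (hr : ∀ i k, HasSum (fun j : Set.Ici n => B i j * A j k) (B i k - A i k)) :
    AreInverse (1 + -infMul A (proj n)) (1 + infMul B (proj n)) := by
  refine ⟨one_add_infMul_one_add fun i k => ?_, one_add_infMul_one_add fun i k => ?_⟩
  · have h := (hasSum_Ici_iff (f := fun j => A i j * B j k)).1 (hl i k)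
    simp only [Matrix.neg_apply, infMul_proj]
    by_cases hi : n ≤ k
    · exact hasSum_of_eq h.neg (fun j => by split_ifs <;> simp)
        (by simp only [hi, if_true]; ring)
    · exact hasSum_of_eq hasSum_zero (fun j => by simp [hi]) (by simp [hi])
  · have h := (hasSum_Ici_iff (f := fun j => B i j * A j k)).1 (hr i k)
    simp only [Matrix.neg_apply, infMul_proj]
    by_cases hi : n ≤ k
    · exact hasSum_of_eq h.neg (fun j => by split_ifs <;> simp)
        (by simp only [hi, if_true]; ring)
    · exact hasSum_of_eq hasSum_zero (fun j => by simp [hi]) (by simp [hi])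

theorem eq_infMul_one_sub
    (hr : ∀ i k, HasSum (fun j : Set.Ici n => B i j * A j k) (B i k - A i k)) :
    A = infMul B (1 + -infMul (proj n) A) := by
  ext i k
  have h := ((hasSum_Ici_iff (f := fun j => B i j * A j k)).1 (hr i k)).neg
  rw [infMul_one_add (s := -(B i k - A i k))]
  · ring
  · simp only [Matrix.neg_apply, proj_infMul]
    exact hasSum_of_eq h (fun j => by split_ifs <;> simp) rfl

theorem eq_one_add_infMul
    (hr : ∀ i k, HasSum (fun j : Set.Ici n => B i j * A j k) (B i k - A i k)) :
    B = infMul (1 + infMul B (proj n)) A := by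
  ext i k
  have h := (hasSum_Ici_iff (f := fun j => B i j * A j k)).1 (hr i k)
  rw [one_add_infMul (s := B i k - A i k)]
  · ring
  · simp only [infMul_proj]
    exact hasSum_of_eq h (fun j => by split_ifs <;> simp) rfl

/-! ### Rows and columns as functionals and vectors of `ℓ²` -/

variable {ι : Type*}

theorem exists_functional_of_summable {a : ι → ℂ} (ha : Summable fun j => ‖a j‖ ^ 2) :
    ∃ φ : lp (fun _ : ι => ℂ) 2 →L[ℂ] ℂ, ∀ y, HasSum (fun j => a j * y j) (φ y) := by
  have hmem : Memℓp (fun j => star (a j)) 2 := memℓp_gen (by simpa using ha)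
  refine ⟨innerSL ℂ (⟨_, hmem⟩ : lp (fun _ : ι => ℂ) 2), fun y => ?_⟩
  have h := lp.hasSum_inner (𝕜 := ℂ) (⟨_, hmem⟩ : lp (fun _ : ι => ℂ) 2) y
  rw [innerSL_apply_apply]
  have e : (fun j => a j * y j) =
      fun j => inner ℂ ((⟨_, hmem⟩ : lp (fun _ : ι => ℂ) 2) j) (y j) := by
    ext j
    simp [mul_comm (a j)]
  rw [e]
  exact h

theorem exists_vector_of_summable {b : ι → ℂ} (hb : Summable fun j => ‖b j‖ ^ 2) :
    ∃ v : lp (fun _ : ι => ℂ) 2, ∀ j, v j = b j :=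
  ⟨⟨b, memℓp_gen (by simpa using hb)⟩, fun _ => rfl⟩

theorem hasSum_functional [DecidableEq ι] (β : lp (fun _ : ι => ℂ) 2 →L[ℂ] ℂ)
    (y : lp (fun _ : ι => ℂ) 2) : HasSum (fun j => β (lp.single 2 j 1) * y j) (β y) := by
  have h := (lp.hasSum_single (by norm_num) y).mapL β
  convert h using 1
  ext j
  rw [mul_comm, ← smul_eq_mul, ← map_smul, ← lp.single_smul, smul_eq_mul, mul_one]

end

section

open Filter Topology

/-! ### Finite sections and their minors -/

theorem tendsto_subtype_atTop (n : ℤ) :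
    Tendsto (fun F : Finset ℤ => F.subtype (· ∈ Set.Ici n)) atTop atTop := by
  refine tendsto_atTop_atTop.2 fun G => ⟨G.map (Function.Embedding.subtype _), fun F hF j hj => ?_⟩
  rw [Finset.mem_subtype]
  exact hF (Finset.mem_map_of_mem _ hj)

/-- A finite set of modes `≥ n` can be enlarged by modes `< n` without changing its part
above `n`. -/
theorem tendsto_of_tendsto_subtype {n : ℤ} {f : Finset (Set.Ici n) → ℂ} {d : ℂ}
    (h : Tendsto (fun F : Finset ℤ => f (F.subtype (· ∈ Set.Ici n))) atTop (𝓝 d)) :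
    Tendsto f atTop (𝓝 d) := by
  intro s hs
  obtain ⟨F₀, hF₀⟩ := mem_atTop_sets.1 (h hs)
  refine mem_atTop_sets.2 ⟨F₀.subtype (· ∈ Set.Ici n), fun G hG => ?_⟩
  have h1 := hF₀ (F₀ ∪ G.map (Function.Embedding.subtype _)) Finset.subset_union_left
  have h2 : (F₀ ∪ G.map (Function.Embedding.subtype _)).subtype (· ∈ Set.Ici n) = G := by
    ext j
    have h3 : (j : ℤ) ∈ F₀ → j ∈ G := fun hj => hG (by simpa using hj)
    simp only [Finset.mem_subtype, Finset.mem_union, Finset.mem_map,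
      Function.Embedding.coe_subtype]
    constructor
    · rintro (hj | ⟨i, hi, hij⟩)
      · exact h3 hj
      · rwa [← Subtype.ext hij]
    · exact fun hj => Or.inr ⟨j, hj, rfl⟩
  rwa [Set.mem_preimage, h2] at h1

theorem cutDet_filter (n : ℤ) (X : Matrix ℤ ℤ ℂ) (F : Finset ℤ) :
    cutDet X (F.filter (n ≤ ·)) =
      (Matrix.of fun j k : F.subtype (· ∈ Set.Ici n) => X j k).det := by
  let e : F.subtype (· ∈ Set.Ici n) ≃ F.filter (n ≤ ·) :=
    { toFun := fun x => ⟨x, Finset.mem_filter.2 ⟨Finset.mem_subtype.1 x.2, x.1.2⟩⟩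
      invFun := fun x => ⟨⟨x, (Finset.mem_filter.1 x.2).2⟩,
        Finset.mem_subtype.2 (Finset.mem_filter.1 x.2).1⟩
      left_inv := fun x => rfl
      right_inv := fun x => rfl }
  rw [cutDet, ← Matrix.det_submatrix_equiv_self e]
  rfl

/-- Rows of the identity matrix do not contribute to a minor. -/
theorem cutDet_eq_cutDet_filter {n : ℤ} {X : Matrix ℤ ℤ ℂ}
    (hX : ∀ i < n, ∀ j, X i j = (1 : Matrix ℤ ℤ ℂ) i j) (F : Finset ℤ) :
    cutDet X F = cutDet X (F.filter (n ≤ ·)) := by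
  let p : F → Prop := fun i => n ≤ (i : ℤ)
  let e : {i // p i} ≃ F.filter (n ≤ ·) :=
    { toFun := fun x => ⟨x, Finset.mem_filter.2 ⟨x.1.2, x.2⟩⟩
      invFun := fun x => ⟨⟨x, (Finset.mem_filter.1 x.2).1⟩, (Finset.mem_filter.1 x.2).2⟩
      left_inv := fun x => rfl
      right_inv := fun x => rfl }
  have h1 : Matrix.toSquareBlockProp (X.submatrix (Subtype.val : F → ℤ) (Subtype.val : F → ℤ))
      (fun i => ¬ p i) = 1 := by
    ext i j
    simp only [Matrix.toSquareBlockProp, Matrix.toBlock_apply, Matrix.submatrix_apply]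
    rw [hX _ (not_le.1 i.2)]
    rcases eq_or_ne i j with rfl | hij
    · rw [Matrix.one_apply_eq, Matrix.one_apply_eq]
    · rw [Matrix.one_apply_ne hij,
        Matrix.one_apply_ne (Subtype.val_injective.ne (Subtype.val_injective.ne hij))]
  rw [cutDet, Matrix.twoBlockTriangular_det _ p, h1, Matrix.det_one, mul_one, cutDet,
    ← Matrix.det_submatrix_equiv_self e]
  · rfl
  · intro i hi j hj
    rw [Matrix.submatrix_apply, hX _ (not_le.1 hi), Matrix.one_apply_ne]
    intro h
    exact hi (show n ≤ (i : ℤ) from h.symm ▸ (hj : n ≤ (j : ℤ)))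

/-- Conjugation with the weights does not change a determinant. -/
theorem det_weighted {m : Type*} [Fintype m] [DecidableEq m] {w : m → ℂ} (hw : ∀ j, w j ≠ 0)
    (X : Matrix m m ℂ) : (Matrix.of fun j k => w j * X j k / w k).det = X.det := by
  have h : (Matrix.of fun j k => w j * X j k / w k) =
      Matrix.diagonal w * X * Matrix.diagonal fun j => (w j)⁻¹ := by
    ext j k
    simp [Matrix.diagonal_mul, Matrix.mul_diagonal, div_eq_mul_inv]
  rw [h, Matrix.det_mul, Matrix.det_mul, mul_right_comm, ← Matrix.det_mul,
    Matrix.diagonal_mul_diagonal]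
  simp [hw]

theorem cutDet_eq_opMinor {n : ℤ} {X : Matrix ℤ ℤ ℂ} {w : ℤ → ℝ} (hw : ∀ k, 0 < w k)
    {T : lp (fun _ : Set.Ici n => ℂ) 2 →L[ℂ] lp (fun _ : Set.Ici n => ℂ) 2}
    (hT : ∀ j k : Set.Ici n, T (lp.single 2 k (1 : ℂ)) j = (w j : ℂ) * X j k / (w k : ℂ))
    (F : Finset ℤ) :
    cutDet X (F.filter (n ≤ ·)) = opMinor T (F.subtype (· ∈ Set.Ici n)) := by
  rw [cutDet_filter, opMinor, ← det_weighted (w := fun j : F.subtype (· ∈ Set.Ici n) => (w j : ℂ))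
    fun j => by exact_mod_cast (hw j).ne']
  congr 1
  ext j k
  simp [hT]

/-! ### The approximation of `A` by finite sections -/

theorem tendsto_cutExp {α : Type*} {l : Filter α} {M : α → Matrix ℤ ℤ ℂ} {A : Matrix ℤ ℤ ℂ}
    (h : ∀ i k, Tendsto (fun x => M x i k) l (𝓝 (A i k))) (c : WithTop ℤ) (S' S : Maya)
    (F : Finset ℤ) : Tendsto (fun x => cutExp c (M x) S' S F) l (𝓝 (cutExp c A S' S F)) := by
  simp only [cutExp_eq_sum]
  refine tendsto_finsetSum _ fun m _ => Tendsto.const_mul _ (tendsto_finsetSum _ fun p _ => ?_)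
  exact (tendsto_finsetProd _ fun a _ => h _ _).mul_const _

/-- Outside a finite set of modes, `S'` and `S` agree with the vacuum `|n⟩`. -/
theorem exists_active_modes (n : ℤ) (S' S : Maya) :
    ∃ F₀ : Finset ℤ, ∀ k ∉ F₀, (k < n → k ∈ S'.modes ∧ k ∈ S.modes) ∧
      (n ≤ k → k ∉ S'.modes ∧ k ∉ S.modes) := by
  obtain ⟨a, ha⟩ := S'.lower
  obtain ⟨b, hb⟩ := S.lower
  obtain ⟨a', ha'⟩ := S'.upper
  obtain ⟨b', hb'⟩ := S.upper
  refine ⟨Finset.Ico (min n (min a b)) (max n (max a' b')), fun k hk =>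
    ⟨fun hkn => ?_, fun hkn => ?_⟩⟩
  · rw [Finset.mem_Ico] at hk
    exact ⟨ha k (by omega), hb k (by omega)⟩
  · rw [Finset.mem_Ico] at hk
    exact ⟨ha' k (by omega), hb' k (by omega)⟩

/-- The matrix elements for the vacuum `|n⟩` involve finitely many modes only, and which ones does
not depend on the matrix. -/
theorem exists_cutExp_eq (n : ℤ) (S' S : Maya) : ∃ F₀ : Finset ℤ, ∀ F, F₀ ⊆ F →
    ∀ A : Matrix ℤ ℤ ℂ, cutExp n A S' S F = cutExp n A S' S F₀ := by
  obtain ⟨F₀, h⟩ := exists_active_modes n S' S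
  refine ⟨F₀, fun F hF A => cutExp_eq_of_vacuum hF fun k _ hk => ?_⟩
  simpa only [WithTop.coe_lt_coe, WithTop.coe_le_coe] using h k hk

/-- The matrices `A` and `B` in the language of `ℓ²`. The weighted rows `A_{ik} / w_k` and
`B_{ik} / w_k`, `k ≥ n`, are continuous functionals, and the weighted columns `w_j B_{jk}`, `j ≥ n`,
are vectors. The row functional of `A` is not named: it is `β i ∘ (1 + K)⁻¹`. -/
structure WeightedSystem (n : ℤ) (A B : Matrix ℤ ℤ ℂ) (w : ℤ → ℝ)
    (K : lp (fun _ : Set.Ici n => ℂ) 2 →L[ℂ] lp (fun _ : Set.Ici n => ℂ) 2) where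
  /-- The rows of `B`. -/
  β : ℤ → lp (fun _ : Set.Ici n => ℂ) 2 →L[ℂ] ℂ
  /-- The columns of `B`. -/
  b : ℤ → lp (fun _ : Set.Ici n => ℂ) 2
  w_pos : ∀ k, 0 < w k
  isUnit : IsUnit (1 + K)
  b_apply : ∀ k (j : Set.Ici n), b k j = (w j : ℂ) * B j k
  K_single : ∀ k : Set.Ici n, K (lp.single 2 k (1 : ℂ)) = (w k : ℂ)⁻¹ • b k
  hasSum_A : ∀ i (y : lp (fun _ : Set.Ici n => ℂ) 2),
    HasSum (fun j : Set.Ici n => A i j / (w j : ℂ) * y j) (β i (Ring.inverse (1 + K) y))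
  hasSum_B : ∀ i (y : lp (fun _ : Set.Ici n => ℂ) 2),
    HasSum (fun j : Set.Ici n => B i j / (w j : ℂ) * y j) (β i y)
  sub_eq : ∀ i k, B i k - A i k = β i (Ring.inverse (1 + K) (b k))

section

variable {n : ℤ} {A B : Matrix ℤ ℤ ℂ} {w : ℤ → ℝ}
  {K : lp (fun _ : Set.Ici n => ℂ) 2 →L[ℂ] lp (fun _ : Set.Ici n => ℂ) 2}

theorem WeightedSystem.w_ne (W : WeightedSystem n A B w K) (k : ℤ) : (w k : ℂ) ≠ 0 := by
  exact_mod_cast (W.w_pos k).ne'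

theorem WeightedSystem.K_apply (W : WeightedSystem n A B w K)
    (y : lp (fun _ : Set.Ici n => ℂ) 2) (j : Set.Ici n) : K y j = (w j : ℂ) * W.β j y := by
  have h1 := hasSum_functional ((lp.evalCLM ℂ (fun _ : Set.Ici n => ℂ) 2 j).comp K) y
  have h2 := (W.hasSum_B j y).mul_left (w j : ℂ)
  refine h1.unique (hasSum_of_eq h2 (fun k => ?_) rfl)
  have h3 : ((lp.evalCLM ℂ (fun _ : Set.Ici n => ℂ) 2 j).comp K) (lp.single 2 k 1) =
      (w k : ℂ)⁻¹ * ((w j : ℂ) * B j k) := by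
    change K (lp.single 2 k 1) j = _
    rw [W.K_single, lp.coeFn_smul, Pi.smul_apply, W.b_apply, smul_eq_mul]
  rw [h3]
  ring

/-- The columns of `A` are the images of those of `B` under `(1 + K)⁻¹`. -/
theorem WeightedSystem.inverse_apply (W : WeightedSystem n A B w K) (k : ℤ) (j : Set.Ici n) :
    Ring.inverse (1 + K) (W.b k) j = (w j : ℂ) * A j k := by
  have h := congrArg (fun T => T (W.b k) j) (Ring.mul_inverse_cancel _ W.isUnit)
  simp only [add_mul, one_mul] at h
  change Ring.inverse (1 + K) (W.b k) j + K (Ring.inverse (1 + K) (W.b k)) j = W.b k j at h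
  rw [W.K_apply, W.b_apply, ← W.sub_eq] at h
  linear_combination h

/-- `A P B = B - A`. -/
theorem WeightedSystem.hasSum_left (W : WeightedSystem n A B w K) (i k : ℤ) :
    HasSum (fun j : Set.Ici n => A i j * B j k) (B i k - A i k) := by
  rw [W.sub_eq]
  refine hasSum_of_eq (W.hasSum_A i (W.b k)) (fun j => ?_) rfl
  have := W.w_ne j
  rw [W.b_apply]
  field_simp

/-- `B P A = B - A`. -/
theorem WeightedSystem.hasSum_right (W : WeightedSystem n A B w K) (i k : ℤ) :
    HasSum (fun j : Set.Ici n => B i j * A j k) (B i k - A i k) := by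
  rw [W.sub_eq]
  refine hasSum_of_eq (W.hasSum_B i (Ring.inverse (1 + K) (W.b k))) (fun j => ?_) rfl
  have := W.w_ne j
  rw [W.inverse_apply]
  field_simp

theorem WeightedSystem.one_add_K_single (W : WeightedSystem n A B w K) (j k : Set.Ici n) :
    (1 + K) (lp.single 2 k (1 : ℂ)) j =
      (w j : ℂ) * (1 + B : Matrix ℤ ℤ ℂ) j k / (w k : ℂ) := by
  have := W.w_ne k
  change (lp.single 2 k (1 : ℂ) : lp (fun _ : Set.Ici n => ℂ) 2) j + K (lp.single 2 k (1 : ℂ)) j = _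
  rw [W.K_single, lp.coeFn_smul, Pi.smul_apply, W.b_apply, smul_eq_mul, Matrix.add_apply]
  rcases eq_or_ne j k with rfl | hjk
  · rw [lp.single_apply_self, Matrix.one_apply_eq]; field_simp
  · rw [lp.single_apply_ne _ _ _ hjk, Matrix.one_apply_ne (Subtype.val_injective.ne hjk)]
    field_simp; ring

theorem WeightedSystem.inverse_single (W : WeightedSystem n A B w K) (j k : Set.Ici n) :
    Ring.inverse (1 + K) (lp.single 2 k (1 : ℂ)) j =
      (w j : ℂ) * (1 + -A : Matrix ℤ ℤ ℂ) j k / (w k : ℂ) := by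
  have := W.w_ne k
  have h := congrArg (fun T => T (lp.single 2 k (1 : ℂ)) j) (Ring.inverse_mul_cancel _ W.isUnit)
  simp only [mul_add, mul_one] at h
  change Ring.inverse (1 + K) (lp.single 2 k (1 : ℂ)) j +
    Ring.inverse (1 + K) (K (lp.single 2 k (1 : ℂ))) j =
      (lp.single 2 k (1 : ℂ) : lp (fun _ : Set.Ici n => ℂ) 2) j at h
  rw [W.K_single, map_smul, lp.coeFn_smul, Pi.smul_apply, W.inverse_apply, smul_eq_mul] at h
  rw [eq_sub_of_add_eq h, Matrix.add_apply, Matrix.neg_apply]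
  rcases eq_or_ne j k with rfl | hjk
  · rw [lp.single_apply_self, Matrix.one_apply_eq]; field_simp; ring
  · rw [lp.single_apply_ne _ _ _ hjk, Matrix.one_apply_ne (Subtype.val_injective.ne hjk)]
    field_simp; ring

/-- The matrix `B - B P_G (1 + P_G B P_G)⁻¹ P_G B`, for the coordinate projection `P_G` of a finite
set `G` of modes `≥ n`. It is to `B` on the modes of `G` as `A` is to `B` on all modes `≥ n`. -/
def WeightedSystem.approx (W : WeightedSystem n A B w K) (G : Finset (Set.Ici n)) :
    Matrix ℤ ℤ ℂ :=
  Matrix.of fun i k => B i k - W.β i (Ring.inverse (1 + coordProj G * K) (coordProj G (W.b k)))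

theorem WeightedSystem.tendsto_approx (W : WeightedSystem n A B w K) (hK : IsCompactOperator K)
    (i k : ℤ) : Tendsto (fun G => W.approx G i k) atTop (𝓝 (A i k)) := by
  have h1 : Tendsto (fun G : Finset (Set.Ici n) =>
      Ring.inverse (1 + coordProj G * K) (coordProj G (W.b k))) atTop
      (𝓝 (Ring.inverse (1 + K) (W.b k))) :=
    (isBoundedBilinearMap_apply.continuous.tendsto (_, _)).comp
      ((tendsto_inverse_section hK W.isUnit).prodMk_nhds (tendsto_coordProj_apply (W.b k)))
  have h2 := (((W.β i).continuous.tendsto _).comp h1).const_sub (B i k)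
  rw [← W.sub_eq, sub_sub_cancel] at h2
  exact h2

/-- The hypothesis of `cutExp_top_eq`. -/
theorem WeightedSystem.approx_sub (W : WeightedSystem n A B w K) {F : Finset ℤ}
    (hu : IsUnit (1 + coordProj (F.subtype (· ∈ Set.Ici n)) * K)) (i k : ℤ) :
    B i k - W.approx (F.subtype (· ∈ Set.Ici n)) i k =
      ∑ j ∈ F with n ≤ j, B i j * W.approx (F.subtype (· ∈ Set.Ici n)) j k := by
  set G := F.subtype (· ∈ Set.Ici n) with hG
  set y := Ring.inverse (1 + coordProj G * K) (coordProj G (W.b k)) with hy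
  have happ : ∀ i, W.approx G i k = B i k - W.β i y := fun i => rfl
  have hsup : ∀ j ∉ G, y j = 0 := fun j hj =>
    inverse_section_apply_eq_zero hu hj (by rw [coordProj_apply, if_neg hj])
  have hval : ∀ j ∈ G, y j = (w j : ℂ) * W.approx G j k := by
    intro j hj
    have h := section_inverse_apply hu (coordProj G (W.b k)) hj
    rw [← hy, coordProj_apply, if_pos hj, W.b_apply] at h
    change y j + K y j = _ at h
    rw [W.K_apply] at h
    rw [happ]
    linear_combination h
  have hsum : W.β i y = ∑ j ∈ G, B i j / (w j : ℂ) * y j :=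
    (W.hasSum_B i y).unique (hasSum_sum_of_ne_finset_zero fun j hj => by rw [hsup j hj, mul_zero])
  have hfil : ∑ j ∈ F with n ≤ j, B i j * W.approx G j k = ∑ j ∈ G, B i j * W.approx G j k := by
    rw [hG, Finset.sum_subtype_eq_sum_filter (p := (· ∈ Set.Ici n))
      (fun j : ℤ => B i j * W.approx G j k)]
    rfl
  rw [hfil, happ, sub_sub_cancel, hsum]
  refine Finset.sum_congr rfl fun j hj => ?_
  have := W.w_ne j
  rw [hval j hj]
  field_simp

end

/-- The row functional `φ_i` of `A` exists by the assumption on the rows of `A`. No such assumption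
is made on the rows of `B`, but `B - A = A P B` shows that `φ_i ∘ (1 + K)` is the row `i` of `B`. -/
theorem exists_weightedSystem {n : ℤ} {A B : Matrix ℤ ℤ ℂ} {w : ℤ → ℝ} (hw : ∀ k, 0 < w k)
    (hA : ∀ i : ℤ, Summable fun k : Set.Ici n => (‖A i k‖ / w k) ^ 2)
    (hB : ∀ k : ℤ, Summable fun i : Set.Ici n => (w i * ‖B i k‖) ^ 2)
    {K : lp (fun _ : Set.Ici n => ℂ) 2 →L[ℂ] lp (fun _ : Set.Ici n => ℂ) 2}
    (hKB : ∀ i k : Set.Ici n, K (lp.single 2 k (1 : ℂ)) i = (w i : ℂ) * B i k / (w k : ℂ))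
    (hinv : IsUnit (1 + K)) (hAB : B - A = infMul (infMul A (proj n)) B) :
    Nonempty (WeightedSystem n A B w K) := by
  have hw0 : ∀ k, (w k : ℂ) ≠ 0 := fun k => by exact_mod_cast (hw k).ne'
  have hφ : ∀ i, ∃ φ : lp (fun _ : Set.Ici n => ℂ) 2 →L[ℂ] ℂ,
      ∀ y, HasSum (fun j : Set.Ici n => A i j / (w j : ℂ) * y j) (φ y) := fun i => by
    refine exists_functional_of_summable (a := fun j : Set.Ici n => A i j / (w j : ℂ)) ?_
    simpa [norm_div, abs_of_pos (hw _)] using hA i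
  have hb : ∀ k, ∃ b : lp (fun _ : Set.Ici n => ℂ) 2, ∀ j, b j = (w j : ℂ) * B j k := fun k => by
    refine exists_vector_of_summable (b := fun j : Set.Ici n => (w j : ℂ) * B j k) ?_
    simpa [norm_mul, abs_of_pos (hw _)] using hB k
  choose φ hφ using hφ
  choose b hb using hb
  have hK : ∀ k : Set.Ici n, K (lp.single 2 k (1 : ℂ)) = (w k : ℂ)⁻¹ • b k := fun k => by
    refine lp.ext (funext fun j => ?_)
    rw [hKB, lp.coeFn_smul, Pi.smul_apply, hb, smul_eq_mul]
    ring
  have hsub : ∀ i k, B i k - A i k = φ i (b k) := by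
    intro i k
    have h1 : HasSum (fun j : Set.Ici n => A i j * B j k) (φ i (b k)) := by
      refine hasSum_of_eq (hφ i (b k)) (fun j => ?_) rfl
      have := hw0 j
      rw [hb]
      field_simp
    rw [hasSum_Ici_iff (f := fun j => A i j * B j k)] at h1
    rw [← Matrix.sub_apply, hAB]
    refine infMul_apply_of_hasSum (hasSum_of_eq h1 (fun j => ?_) rfl)
    rw [infMul_proj]
    split_ifs <;> simp
  have hcancel : ∀ i y, (φ i).comp (1 + K) (Ring.inverse (1 + K) y) = φ i y := fun i y => by
    change φ i (((1 + K) * Ring.inverse (1 + K)) y) = _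
    rw [Ring.mul_inverse_cancel _ hinv]
    rfl
  refine ⟨⟨fun i => (φ i).comp (1 + K), b, hw, hinv, hb, hK, fun i y => ?_, fun i y => ?_,
    fun i k => ?_⟩⟩
  · rw [hcancel]
    exact hφ i y
  · have h := hasSum_functional ((φ i).comp (1 + K)) y
    refine hasSum_of_eq h (fun j => ?_) rfl
    congr 1
    change _ = φ i (lp.single 2 j 1 + K (lp.single 2 j 1))
    have h2 := (hφ i (lp.single 2 j 1)).unique (hasSum_single j fun k hk => by
      rw [lp.single_apply_ne _ _ _ hk, mul_zero])
    rw [map_add, h2, hK, map_smul, ← hsub, lp.single_apply_self, smul_eq_mul]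
    have := hw0 j
    field_simp
    ring
  · rw [hcancel, hsub]

end

section

open Filter Topology

/-! ### Passage to the limit -/

variable {n : ℤ} {A B : Matrix ℤ ℤ ℂ} {w : ℤ → ℝ}
  {K : lp (fun _ : Set.Ici n => ℂ) 2 →L[ℂ] lp (fun _ : Set.Ici n => ℂ) 2}

theorem cutDet_one_add_proj_infMul (n : ℤ) (X : Matrix ℤ ℤ ℂ) (F : Finset ℤ) :
    cutDet (1 + infMul (proj n) X) F = cutDet (1 + X) (F.filter (n ≤ ·)) := by
  rw [cutDet_eq_cutDet_filter (n := n)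
    fun i hi j => by rw [Matrix.add_apply, proj_infMul, if_neg (not_le.2 hi), add_zero]]
  rw [cutDet, cutDet]
  congr 1
  ext i j
  simp only [Matrix.submatrix_apply, Matrix.add_apply]
  rw [proj_infMul, if_pos (Finset.mem_filter.1 i.2).2]

theorem one_sub_proj_infMul (n : ℤ) (X : Matrix ℤ ℤ ℂ) :
    1 - infMul (proj n) X = 1 + infMul (proj n) (-X) := by
  ext i k
  rw [Matrix.sub_apply, Matrix.add_apply, proj_infMul, proj_infMul, Matrix.neg_apply]
  split_ifs <;> ring

theorem WeightedSystem.cutDet_one_add (W : WeightedSystem n A B w K) (F : Finset ℤ) :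
    cutDet (1 + infMul (proj n) B) F = opMinor (1 + K) (F.subtype (· ∈ Set.Ici n)) := by
  rw [cutDet_one_add_proj_infMul, cutDet_eq_opMinor W.w_pos W.one_add_K_single]

theorem WeightedSystem.cutDet_one_sub (W : WeightedSystem n A B w K) (F : Finset ℤ) :
    cutDet (1 - infMul (proj n) A) F =
      opMinor (Ring.inverse (1 + K)) (F.subtype (· ∈ Set.Ici n)) := by
  rw [one_sub_proj_infMul, cutDet_one_add_proj_infMul,
    cutDet_eq_opMinor W.w_pos W.inverse_single]

/-- The limit of `cutExp_top_eq`, applied to the finite sections of `B`. -/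
theorem WeightedSystem.tendsto_cutExp_top (W : WeightedSystem n A B w K)
    (hK : IsCompactOperator K) {d : ℂ}
    (hd : Tendsto (cutDet (1 + infMul (proj n) B)) atTop (𝓝 d)) {S' S : Maya} {x : ℂ}
    (hx : Tendsto (cutExp n A S' S) atTop (𝓝 x)) :
    Tendsto (cutExp ⊤ B S' S) atTop (𝓝 (d * x)) := by
  obtain ⟨F₀, hF₀⟩ := exists_cutExp_eq n S' S
  have hx' : x = cutExp n A S' S F₀ :=
    tendsto_nhds_unique hx (tendsto_const_nhds.congr' ((eventually_ge_atTop F₀).mono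
      fun F hF => (hF₀ F hF A).symm))
  have h1 : Tendsto (fun F : Finset ℤ =>
      cutExp n (W.approx (F.subtype (· ∈ Set.Ici n))) S' S F₀) atTop (𝓝 x) := by
    rw [hx']
    exact tendsto_cutExp
      (fun i k => (W.tendsto_approx hK i k).comp (tendsto_subtype_atTop n)) n S' S F₀
  refine (hd.mul h1).congr' ?_
  filter_upwards [eventually_ge_atTop F₀,
    (tendsto_subtype_atTop n).eventually (eventually_isUnit_section hK W.isUnit)] with F hF hu
  rw [cutExp_top_eq (fun i _ k _ => W.approx_sub hu i k), hF₀ F hF, cutDet_one_add_proj_infMul]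

theorem normalExpConverges_coe (n : ℤ) (A : Matrix ℤ ℤ ℂ) (S' S : Maya) :
    NormalExpConverges n A S' S := by
  obtain ⟨F₀, hF₀⟩ := exists_cutExp_eq n S' S
  exact ⟨_, tendsto_const_nhds.congr' ((eventually_ge_atTop F₀).mono
    fun F hF => (hF₀ F hF A).symm)⟩

end

end FreeFermion

end

theorem mainTheorem7 (n : ℤ) (A B : Matrix ℤ ℤ ℂ) (w : ℤ → ℝ) (hw : ∀ k, 0 < w k)
    (hA : ∀ i : ℤ, Summable fun k : Set.Ici n => (‖A i k‖ / w k) ^ 2)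
    (hB : ∀ k : ℤ, Summable fun i : Set.Ici n => (w i * ‖B i k‖) ^ 2)
    (K : lp (fun _ : Set.Ici n => ℂ) 2 →L[ℂ] lp (fun _ : Set.Ici n => ℂ) 2)
    (hK : IsCompactOperator K)
    (hKB : ∀ i k : Set.Ici n, K (lp.single 2 k (1 : ℂ)) i = (w i : ℂ) * B i k / (w k : ℂ))
    (hinv : IsUnit (1 + K))
    (hAB : B - A = infMul (infMul A (proj n)) B)
    (hdet : InfDetConverges (1 + infMul (proj n) B)) :
    (∃ C, AreInverse (1 + infMul (proj n) B) C ∧ A = infMul B C) ∧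
    (∃ C, AreInverse (1 - infMul A (proj n)) C ∧ B = infMul C A) ∧
    (∀ S' S : Maya, NormalExpConverges ⊤ B S' S ∧ NormalExpConverges (n : WithTop ℤ) A S' S ∧
      normalExp ⊤ B S' S =
        infDet (1 + infMul (proj n) B) * normalExp (n : WithTop ℤ) A S' S) ∧
    (infDet (1 + infMul (proj n) B) ≠ 0 →
      InfDetConverges (1 - infMul (proj n) A) ∧
      ∀ S' S : Maya, normalExp (n : WithTop ℤ) A S' S =
        infDet (1 - infMul (proj n) A) * normalExp ⊤ B S' S) := by
  obtain ⟨W⟩ := exists_weightedSystem hw hA hB hKB hinv hAB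
  obtain ⟨d, hd⟩ := hdet
  have hinf : infDet (1 + infMul (proj n) B) = d := hd.limUnder_eq
  have hexp : ∀ S' S : Maya, NormalExpConverges ⊤ B S' S ∧
      NormalExpConverges (n : WithTop ℤ) A S' S ∧
      normalExp ⊤ B S' S = d * normalExp (n : WithTop ℤ) A S' S := fun S' S => by
    obtain ⟨x, hx⟩ := normalExpConverges_coe n A S' S
    have hB := W.tendsto_cutExp_top hK hd hx
    refine ⟨⟨_, hB⟩, ⟨x, hx⟩, ?_⟩
    rw [normalExp, normalExp, hB.limUnder_eq, hx.limUnder_eq]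
  refine ⟨⟨_, areInverse_one_add_proj_infMul W.hasSum_left W.hasSum_right,
    eq_infMul_one_sub W.hasSum_right⟩, ⟨1 + infMul B (proj n), ?_,
    eq_one_add_infMul W.hasSum_right⟩, ?_, ?_⟩
  · rw [sub_eq_add_neg]
    exact areInverse_one_sub_infMul_proj W.hasSum_left W.hasSum_right
  · rwa [hinf]
  · rw [hinf]
    intro hd0
    have hminor : Filter.Tendsto (opMinor (1 + K)) Filter.atTop (nhds d) :=
      tendsto_of_tendsto_subtype (hd.congr W.cutDet_one_add)
    have hd' : Filter.Tendsto (cutDet (1 - infMul (proj n) A)) Filter.atTop (nhds d⁻¹) :=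
      ((tendsto_opMinor_inverse hK W.isUnit hminor hd0).comp (tendsto_subtype_atTop n)).congr
        fun F => (W.cutDet_one_sub F).symm
    refine ⟨⟨_, hd'⟩, fun S' S => ?_⟩
    rw [infDet, hd'.limUnder_eq, (hexp S' S).2.2, inv_mul_cancel_left₀ hd0]
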